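/- Let $n\ge 1$ and $p\ge 0$ be integers with $n-p-1>0$. For $M\in\mathbb{R}^{n\times p}$ let $X\in\mathbb{R}^{n\times p}$ have independent entries $X_{ij}\sim \mathrm{N}(M_{ij},1)$, and write $\mathrm{E}_M$ for expectation under this law. For an estimator $\hat M=\hat M(X)$ (a measurable function of $X$ with values in $\mathbb{R}^{n\times p}$), let $R(M,\hat M)=\mathrm{E}_M[(\hat M(X)-M)^{\top}(\hat M(X)-M)]$ be its matrix quadratic risk, where $c^{\top}R(M,\hat M)c$ is understood as $\mathrm{E}_M[\|\hat M(X)c-Mc\|^2]\in[0,\infty]$ for $c\in\mathbb{R}^p$. Call $\hat M$ minimax under the matrix quadratic loss if, for every $c\in\mathbb{R}^p$, $$\sup_M c^{\top}R(M,\hat M)c=\inf_{\hat M'}\sup_M c^{\top}R(M,\hat M')c,$$ where the infimum is over all estimators $\hat M'$ and the suprema are over all $M\in\mathbb{R}^{n\times p}$. Then the Efron–Morris estimator $$\hat M_{\mathrm{EM}}=X\left(I_p-(n-p-1)(X^{\top}X)^{-1}\right)$$ is minimax under the matrix quadratic loss. Moreover, for every $M\in\mathbb{R}^{n\times p}$,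 the matrix $X^{\top}X$ is almost surely invertible, the entries of $(X^{\top}X)^{-1}$ and of the loss $(\hat M_{\mathrm{EM}}-M)^{\top}(\hat M_{\mathrm{EM}}-M)$ are integrable, and $$R(M,\hat M_{\mathrm{EM}})=n I_p-(n-p-1)^2\,\mathrm{E}_M[(X^{\top}X)^{-1}]\preceq n I_p,$$ where $A\preceq B$ means that $B-A$ is positive semidefinite. -/

import Mathlib

open MeasureTheory ProbabilityTheory
open scoped Matrix ENNReal

namespace MatrixQuadratic

/-- The product (equivalently Borel) σ-algebra on real matrices. -/
instance instMeasurableSpaceMatrix {n p : ℕ} : MeasurableSpace (Matrix (Fin n) (Fin p) ℝ) :=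
  inferInstanceAs (MeasurableSpace (Fin n → Fin p → ℝ))

/-- The matrix-variate normal distribution `N_{n,p}(M, I_n, I_p)`: the law of an `n × p` random
matrix whose entries are independent with `X i j ∼ N(M i j, 1)`. -/
noncomputable def matrixNormal {n p : ℕ} (M : Matrix (Fin n) (Fin p) ℝ) :
    Measure (Matrix (Fin n) (Fin p) ℝ) :=
  Measure.pi fun i : Fin n => Measure.pi fun j : Fin p => gaussianReal (M i j) 1

/-- The matrix quadratic loss `L(M, D) = (D - M)ᵀ (D - M)`, a `p × p` matrix. -/
def matrixLoss {n p : ℕ} (M D : Matrix (Fin n) (Fin p) ℝ) : Matrix (Fin p) (Fin p) ℝ :=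
  (D - M)ᵀ * (D - M)

/-- The matrix quadratic risk `R(M, δ) = E_M [L(M, δ(X))]`, the expectation being taken entrywise.
It is meaningful when the entries of the loss are integrable. -/
noncomputable def matrixRisk {n p : ℕ} (M : Matrix (Fin n) (Fin p) ℝ)
    (δ : Matrix (Fin n) (Fin p) ℝ → Matrix (Fin n) (Fin p) ℝ) : Matrix (Fin p) (Fin p) ℝ :=
  Matrix.of fun i j => ∫ X, matrixLoss M (δ X) i j ∂(matrixNormal M)

/-- The quadratic form `cᵀ R(M, δ) c = E_M [cᵀ L(M, δ(X)) c] = E_M [‖δ(X) c - M c‖²]` of the risk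
in the direction `c`, as an extended nonnegative real, so that it is also defined (possibly as
`∞`) for estimators whose loss is not integrable. -/
noncomputable def directionalRisk {n p : ℕ} (M : Matrix (Fin n) (Fin p) ℝ)
    (δ : Matrix (Fin n) (Fin p) ℝ → Matrix (Fin n) (Fin p) ℝ) (c : Fin p → ℝ) : ℝ≥0∞ :=
  ∫⁻ X, ENNReal.ofReal (c ⬝ᵥ (matrixLoss M (δ X) *ᵥ c)) ∂(matrixNormal M)

/-- Whenever the risk matrix exists, the directional risk is its quadratic form. -/
theorem directionalRisk_eq {n p : ℕ} (M : Matrix (Fin n) (Fin p) ℝ)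
    (δ : Matrix (Fin n) (Fin p) ℝ → Matrix (Fin n) (Fin p) ℝ) (c : Fin p → ℝ)
    (h : ∀ i j, Integrable (fun X => matrixLoss M (δ X) i j) (matrixNormal M)) :
    directionalRisk M δ c = ENNReal.ofReal (c ⬝ᵥ (matrixRisk M δ *ᵥ c)) := by
  have hI : ∀ i j, Integrable (fun X => c i * (matrixLoss M (δ X) i j * c j)) (matrixNormal M) :=
    fun i j => ((h i j).mul_const _).const_mul _
  have h0 : ∀ X, 0 ≤ c ⬝ᵥ (matrixLoss M (δ X) *ᵥ c) := fun X => by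
    have := (Matrix.posSemidef_conjTranspose_mul_self (δ X - M)).dotProduct_mulVec_nonneg c
    simpa [matrixLoss, Matrix.conjTranspose_eq_transpose_of_trivial] using this
  have hE : (fun X => c ⬝ᵥ (matrixLoss M (δ X) *ᵥ c)) =
      fun X => ∑ i, ∑ j, c i * (matrixLoss M (δ X) i j * c j) := by
    funext X
    simp [dotProduct, Matrix.mulVec, Finset.mul_sum]
  rw [directionalRisk, ← ofReal_integral_eq_lintegral_ofReal _ (Filter.Eventually.of_forall h0)]
  · rw [hE, integral_finsetSum _ fun i _ => integrable_finsetSum _ fun j _ => hI i j]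
    congr 1
    simp only [dotProduct, Matrix.mulVec, matrixRisk, Matrix.of_apply, Finset.mul_sum]
    refine Finset.sum_congr rfl fun i _ => ?_
    rw [integral_finsetSum _ fun j _ => hI i j]
    refine Finset.sum_congr rfl fun j _ => ?_
    rw [integral_const_mul, integral_mul_const]
  · rw [hE]
    exact integrable_finsetSum _ fun i _ => integrable_finsetSum _ fun j _ => hI i j

/-- An estimator `δ` (a measurable function of the observation) is minimax under the matrix
quadratic loss if `sup_M cᵀ R(M, δ) c = inf_{δ'} sup_M cᵀ R(M, δ') c` for every `c ∈ ℝᵖ`, the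
infimum being over all estimators. -/
def IsMinimax {n p : ℕ} (δ : Matrix (Fin n) (Fin p) ℝ → Matrix (Fin n) (Fin p) ℝ) : Prop :=
  Measurable δ ∧ ∀ c : Fin p → ℝ,
    (⨆ M : Matrix (Fin n) (Fin p) ℝ, directionalRisk M δ c) =
      ⨅ (δ' : Matrix (Fin n) (Fin p) ℝ → Matrix (Fin n) (Fin p) ℝ) (_ : Measurable δ'),
        ⨆ M : Matrix (Fin n) (Fin p) ℝ, directionalRisk M δ' c

/-- The Efron–Morris estimator `X (I_p - (n - p - 1) (Xᵀ X)⁻¹)`. -/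
noncomputable def efronMorris {n p : ℕ} (X : Matrix (Fin n) (Fin p) ℝ) :
    Matrix (Fin n) (Fin p) ℝ :=
  X * (1 - ((n : ℝ) - (p : ℝ) - 1) • (Xᵀ * X)⁻¹)

/-- The entrywise expectation `E_M [(Xᵀ X)⁻¹]`. -/
noncomputable def expectedInvGram {n p : ℕ} (M : Matrix (Fin n) (Fin p) ℝ) :
    Matrix (Fin p) (Fin p) ℝ :=
  Matrix.of fun i j => ∫ X : Matrix (Fin n) (Fin p) ℝ, (Xᵀ * X)⁻¹ i j ∂(matrixNormal M)

end MatrixQuadratic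

/-! Write S = XᵀX and d = n - p - 1 > 0. The estimator is X - d X S⁻¹, so its loss is (X-M)ᵀ(X-M),
minus d times (X-M)ᵀXS⁻¹ and its transpose, plus d² S⁻¹. Stein's identity (`stein_matrixNormal`)
replaces the cross term by the matrix divergence of X S⁻¹, which is d S⁻¹. The risk is therefore nI
- 2d² E S⁻¹ + d² E S⁻¹, and E S⁻¹ ⪰ 0 bounds every directional risk by n‖c‖².

Integrability of S⁻¹ is not known beforehand, so Stein's identity is first applied to XB with B = (S
+ εI)⁻¹, which is smooth and bounded. Its divergence is dB + εB² + ε tr(B) B (`sum_ridge_deriv`), at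
least dB on the diagonal. Young's inequality then gives E B_jj ≤ n/d² uniformly in ε
(`integral_ridgeInv_apply_le`). Since tr B blows up where S is singular, Fatou's lemma yields both
almost sure invertibility of S and integrability of tr S⁻¹, and the latter dominates the passage ε →
0.

For minimaxity, `le_lintegral_directionalRisk` bounds the Bayes risk below by cos²θ · n‖c‖² for the
Gaussian prior of scale cot θ. A rotation splits the prior and the noise into the observation and an
independent residual that no estimator can predict. Letting θ → 0 gives n‖c‖², which matches the
upper bound. -/

namespace MatrixQuadratic

/-! ### Stein's identity: one variable, then one entry of a Gaussian matrix -/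

/-- Derivative of the density of `N(m, 1)`. -/
theorem hasDerivAt_gaussianPDFReal (m x : ℝ) :
    HasDerivAt (gaussianPDFReal m 1) (-((x - m) * gaussianPDFReal m 1 x)) x := by
  have h1 : HasDerivAt (fun x : ℝ => -(x - m) ^ 2 / (2 * ((1 : NNReal) : ℝ))) (-(x - m)) x := by
    have := ((((hasDerivAt_id' x).sub_const m).fun_pow 2).fun_neg).div_const
      (2 * ((1 : NNReal) : ℝ))
    exact this.congr_deriv (by norm_num; ring)
  have h2 := (h1.exp).const_mul (√(2 * Real.pi * ((1 : NNReal) : ℝ)))⁻¹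
  refine h2.congr_deriv ?_
  simp only [gaussianPDFReal]
  ring

theorem integrable_gaussianReal_iff (m : ℝ) (f : ℝ → ℝ) :
    Integrable f (gaussianReal m 1) ↔ Integrable (fun x => gaussianPDFReal m 1 x * f x) := by
  rw [gaussianReal_of_var_ne_zero m one_ne_zero,
    integrable_withDensity_iff_integrable_smul' (measurable_gaussianPDF m 1)
      (Filter.Eventually.of_forall fun _ => gaussianPDF_lt_top)]
  simp [toReal_gaussianPDF]

/-- Stein's identity for the normal distribution with unit variance. -/
theorem stein_gaussianReal (m : ℝ) {f f' : ℝ → ℝ} (hf : ∀ x, HasDerivAt f (f' x) x)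
    (hi : Integrable f (gaussianReal m 1)) (hi' : Integrable f' (gaussianReal m 1))
    (hx : Integrable (fun x => (x - m) * f x) (gaussianReal m 1)) :
    ∫ x, (x - m) * f x ∂(gaussianReal m 1) = ∫ x, f' x ∂(gaussianReal m 1) := by
  rw [integrable_gaussianReal_iff] at hi hi' hx
  rw [integral_gaussianReal_eq_integral_smul one_ne_zero,
    integral_gaussianReal_eq_integral_smul one_ne_zero]
  -- Integration by parts on the whole line with u the density, u' = -(x - m)u; integrability of the
  -- three products replaces any boundary condition.
  have key := integral_mul_deriv_eq_deriv_mul_of_integrable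
    (u := gaussianPDFReal m 1) (v := f) (u' := fun x => -((x - m) * gaussianPDFReal m 1 x))
    (v' := f') (fun x _ => hasDerivAt_gaussianPDFReal m x) (fun x _ => hf x) hi'
    (by convert hx.neg using 1; ext x; simp; ring) hi
  simp only [smul_eq_mul]
  rw [key, ← integral_neg]
  congr 1
  ext x
  ring

/-- Resampling one coordinate preserves a product of probability measures. -/
theorem measurePreserving_update {ι : Type*} [Fintype ι] [DecidableEq ι] {α : ι → Type*}
    [∀ i, MeasurableSpace (α i)] (μ : ∀ i, Measure (α i)) [∀ i, IsProbabilityMeasure (μ i)]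
    (i : ι) :
    MeasurePreserving (fun q : (∀ i, α i) × α i => Function.update q.1 i q.2)
      ((Measure.pi μ).prod (μ i)) (Measure.pi μ) := by
  have hm : Measurable (fun q : (∀ i, α i) × α i => Function.update q.1 i q.2) :=
    measurable_update'
  refine ⟨hm, (Measure.pi_eq fun s hs => ?_).symm⟩
  rw [Measure.map_apply hm (MeasurableSet.univ_pi hs)]
  have : (fun q : (∀ i, α i) × α i => Function.update q.1 i q.2) ⁻¹' Set.univ.pi s =
      (Set.univ.pi (Function.update s i Set.univ)) ×ˢ s i := by
    ext ⟨x, t⟩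
    simp only [Set.mem_preimage, Set.mem_univ_pi, Set.mem_prod]
    constructor
    · intro h
      refine ⟨fun j => ?_, by simpa using h i⟩
      by_cases hj : j = i
      · subst hj; simp
      · simpa [Function.update_of_ne hj] using h j
    · rintro ⟨h, ht⟩ j
      by_cases hj : j = i
      · subst hj; simpa using ht
      · simpa [Function.update_of_ne hj] using h j
  rw [this, Measure.prod_prod, Measure.pi_pi,
    ← Finset.mul_prod_erase Finset.univ (fun j => μ j (s j)) (Finset.mem_univ i),
    ← Finset.mul_prod_erase Finset.univ _ (Finset.mem_univ i), Function.update_self,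
    measure_univ, one_mul, mul_comm]
  congr 1
  refine Finset.prod_congr rfl fun j hj => ?_
  rw [Function.update_of_ne (Finset.ne_of_mem_erase hj)]

theorem integrable_update {ι : Type*} [Fintype ι] [DecidableEq ι] {α : ι → Type*}
    [∀ i, MeasurableSpace (α i)] (μ : ∀ i, Measure (α i)) [∀ i, IsProbabilityMeasure (μ i)]
    (i : ι) {f : (∀ i, α i) → ℝ} (hf : Integrable f (Measure.pi μ)) :
    ∀ᵐ x ∂(Measure.pi μ), Integrable (fun t => f (Function.update x i t)) (μ i) :=
  ((measurePreserving_update μ i).integrable_comp_of_integrable hf).prod_right_ae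

theorem integral_update {ι : Type*} [Fintype ι] [DecidableEq ι] {α : ι → Type*}
    [∀ i, MeasurableSpace (α i)] (μ : ∀ i, Measure (α i)) [∀ i, IsProbabilityMeasure (μ i)]
    (i : ι) {f : (∀ i, α i) → ℝ} (hf : Integrable f (Measure.pi μ)) :
    ∫ x, f x ∂(Measure.pi μ) =
      ∫ x, ∫ t, f (Function.update x i t) ∂(μ i) ∂(Measure.pi μ) := by
  have h := measurePreserving_update μ i
  refine Eq.trans ?_ (integral_prod _ (h.integrable_comp_of_integrable hf))
  conv_lhs => rw [← h.map_eq]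
  rw [integral_map h.measurable.aemeasurable (by rw [h.map_eq]; exact hf.aestronglyMeasurable)]
  rfl

instance instIsProbabilityMeasureMatrixNormal {n p : ℕ} (M : Matrix (Fin n) (Fin p) ℝ) :
    IsProbabilityMeasure (matrixNormal M) := by
  have : ∀ i : Fin n, IsProbabilityMeasure (Measure.pi fun j : Fin p => gaussianReal (M i j) 1) :=
    fun _ => inferInstance
  exact Measure.pi.instIsProbabilityMeasure _

/-- Stein's identity for one coordinate of a vector of independent normal variables. -/
theorem stein_pi {p : ℕ} (m : Fin p → ℝ) (i : Fin p) {g g' : (Fin p → ℝ) → ℝ}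
    (hg : ∀ x t, HasDerivAt (fun t => g (Function.update x i t)) (g' (Function.update x i t)) t)
    (hi : Integrable g (Measure.pi fun j => gaussianReal (m j) 1))
    (hi' : Integrable g' (Measure.pi fun j => gaussianReal (m j) 1))
    (hx : Integrable (fun x => (x i - m i) * g x) (Measure.pi fun j => gaussianReal (m j) 1)) :
    ∫ x, (x i - m i) * g x ∂(Measure.pi fun j => gaussianReal (m j) 1) =
      ∫ x, g' x ∂(Measure.pi fun j => gaussianReal (m j) 1) := by
  rw [integral_update _ i hx, integral_update _ i hi']
  refine integral_congr_ae ?_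
  filter_upwards [integrable_update _ i hi, integrable_update _ i hi', integrable_update _ i hx]
    with x h1 h2 h3
  simp only [Function.update_self] at h3 ⊢
  exact stein_gaussianReal (m i) (hg x) h1 h2 h3

/-- Stein's identity for one entry of a matrix-variate normal distribution. -/
theorem stein_matrixNormal {n p : ℕ} (M : Matrix (Fin n) (Fin p) ℝ) (k : Fin n) (i : Fin p)
    {g g' : Matrix (Fin n) (Fin p) ℝ → ℝ}
    (hg : ∀ X, HasDerivAt (fun t : ℝ => g (X + t • Matrix.single k i 1)) (g' X) 0)
    (hi : Integrable g (matrixNormal M)) (hi' : Integrable g' (matrixNormal M))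
    (hx : Integrable (fun X => (X k i - M k i) * g X) (matrixNormal M)) :
    ∫ X, (X k i - M k i) * g X ∂(matrixNormal M) = ∫ X, g' X ∂(matrixNormal M) := by
  have : ∀ i : Fin n, IsProbabilityMeasure (Measure.pi fun j : Fin p => gaussianReal (M i j) 1) :=
    fun _ => inferInstance
  unfold matrixNormal at *
  refine (integral_update _ k hx).trans (Eq.trans ?_ (integral_update _ k hi').symm)
  refine integral_congr_ae ?_
  filter_upwards [integrable_update _ k hi, integrable_update _ k hi', integrable_update _ k hx]
    with X h1 h2 h3
  simp only [Function.update_self] at h3 ⊢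
  refine stein_pi (M k) i (g := fun r => g (Function.update X k r))
    (g' := fun r => g' (Function.update X k r)) (fun r t => ?_) h1 h2 h3
  have h := hg (Function.update X k (Function.update r i t))
  -- `hg` only gives derivatives at 0; based at the updated matrix and translated by t, it gives the
  -- derivative of the coordinate slice at t.
  have h' := HasDerivAt.comp_sub_const t t (by rwa [sub_self])
  refine h'.congr_of_eventuallyEq (Filter.Eventually.of_forall fun s => ?_)
  simp only
  congr 1
  ext a b
  change _ = Function.update X k (Function.update r i t) a b +
    (s - t) * (Matrix.single k i (1 : ℝ)) a b
  rw [Matrix.single_apply]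
  by_cases ha : a = k
  · subst ha
    by_cases hb : b = i
    · subst hb; simp
    · simp [Function.update_of_ne hb, Ne.symm hb]
  · simp [Function.update_of_ne ha, Ne.symm ha]

/-! ### Derivative of the matrix inverse and an entry bound -/

section MatrixInv
attribute [local instance] Matrix.linftyOpNormedRing Matrix.linftyOpNormedAlgebra
  Matrix.linftyOpNormedAddCommGroup

/-- The local operator norm makes matrices a normed algebra, where inversion has derivative H ↦
-A⁻¹HA⁻¹; the entrywise statement is free of the norm. -/
theorem hasDerivAt_matrix_inv {p : ℕ} {A A' : ℝ → Matrix (Fin p) (Fin p) ℝ} {t : ℝ}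
    (hA : ∀ a b, HasDerivAt (fun s => A s a b) (A' t a b) t) (hu : IsUnit (A t)) (a b : Fin p) :
    HasDerivAt (fun s => (A s)⁻¹ a b) (-((A t)⁻¹ * A' t * (A t)⁻¹) a b) t := by
  have hA' : HasDerivAt A (A' t) t := hasDerivAt_pi.2 fun a => hasDerivAt_pi.2 fun b => hA a b
  obtain ⟨u, hu⟩ := hu
  have h1 := hasFDerivAt_ringInverse (𝕜 := ℝ) u
  rw [hu] at h1
  have h2 := h1.comp_hasDerivAt t hA'
  have h3 := hasDerivAt_pi.1 (hasDerivAt_pi.1 h2 a) b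
  rw [Matrix.nonsing_inv_eq_ringInverse, ← hu, Ring.inverse_unit]
  simp only [Matrix.nonsing_inv_eq_ringInverse]
  refine h3.congr_deriv ?_
  simp
end MatrixInv

/-- Testing the form on e_i ± e_j gives 2|A_ij| ≤ A_ii + A_jj. This makes the trace the single
dominating function of all later estimates. -/
theorem _root_.Matrix.PosSemidef.abs_apply_le_trace {p : ℕ} {A : Matrix (Fin p) (Fin p) ℝ}
    (hA : A.PosSemidef) (i j : Fin p) : |A i j| ≤ A.trace := by
  have hd : ∀ k, 0 ≤ A k k := fun k => hA.diag_nonneg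
  have htr : ∀ k, A k k ≤ A.trace := fun k =>
    Finset.single_le_sum (f := fun k => A k k) (fun k _ => hd k) (Finset.mem_univ k)
  have hs : A j i = A i j := by simpa using hA.1.apply i j
  have h1 := hA.dotProduct_mulVec_nonneg (Pi.single i 1 + Pi.single j 1)
  have h2 := hA.dotProduct_mulVec_nonneg (Pi.single i 1 - Pi.single j 1)
  simp [Matrix.mulVec_add, Matrix.mulVec_sub, dotProduct_add, dotProduct_sub, add_dotProduct,
    sub_dotProduct, hs] at h1 h2
  rw [abs_le]
  constructor <;> linarith [htr i, htr j]

/-! ### Algebra and calculus of the ridge inverse B -/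

/-- The regularised inverse `(Xᵀ X + ε I)⁻¹` of the Gram matrix. -/
noncomputable def ridgeInv {n p : ℕ} (ε : ℝ) (X : Matrix (Fin n) (Fin p) ℝ) :
    Matrix (Fin p) (Fin p) ℝ :=
  (Xᵀ * X + ε • (1 : Matrix (Fin p) (Fin p) ℝ))⁻¹

section Ridge

variable {n p : ℕ} {ε : ℝ} (X : Matrix (Fin n) (Fin p) ℝ)

theorem posSemidef_gram : (Xᵀ * X).PosSemidef := by
  simpa using Matrix.posSemidef_conjTranspose_mul_self X

theorem posDef_gram_add (hε : 0 < ε) :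
    (Xᵀ * X + ε • (1 : Matrix (Fin p) (Fin p) ℝ)).PosDef :=
  Matrix.PosDef.posSemidef_add (posSemidef_gram X) (Matrix.PosDef.one.smul hε)

theorem posSemidef_ridgeInv (hε : 0 < ε) : (ridgeInv ε X).PosSemidef :=
  (posDef_gram_add X hε).posSemidef.inv

theorem transpose_ridgeInv : (ridgeInv ε X)ᵀ = ridgeInv ε X := by
  simp [ridgeInv, Matrix.transpose_nonsing_inv]

theorem isUnit_gram_add (hε : 0 < ε) :
    IsUnit (Xᵀ * X + ε • (1 : Matrix (Fin p) (Fin p) ℝ)) :=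
  (posDef_gram_add X hε).isUnit

theorem gram_mul_ridgeInv (hε : 0 < ε) : Xᵀ * X * ridgeInv ε X = 1 - ε • ridgeInv ε X := by
  have h := Matrix.mul_nonsing_inv _
    ((Matrix.isUnit_iff_isUnit_det _).1 (isUnit_gram_add X hε))
  rw [add_mul, smul_mul_assoc, one_mul] at h
  exact eq_sub_of_add_eq h

theorem ridgeInv_mul_gram (hε : 0 < ε) : ridgeInv ε X * (Xᵀ * X) = 1 - ε • ridgeInv ε X := by
  have h := Matrix.nonsing_inv_mul _
    ((Matrix.isUnit_iff_isUnit_det _).1 (isUnit_gram_add X hε))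
  rw [mul_add, mul_smul_comm, mul_one] at h
  exact eq_sub_of_add_eq h

theorem gram_mul_ridge (hε : 0 < ε) :
    (X * ridgeInv ε X)ᵀ * (X * ridgeInv ε X) =
      ridgeInv ε X - ε • (ridgeInv ε X * ridgeInv ε X) := by
  rw [Matrix.transpose_mul, transpose_ridgeInv, Matrix.mul_assoc, ← Matrix.mul_assoc Xᵀ,
    gram_mul_ridgeInv X hε, mul_sub, mul_one, mul_smul_comm]

theorem posSemidef_ridgeInv_sq : (ridgeInv ε X * ridgeInv ε X).PosSemidef := by
  simpa [transpose_ridgeInv] using Matrix.posSemidef_conjTranspose_mul_self (ridgeInv ε X)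

/-- The left side is a diagonal entry of (XB)ᵀ(XB) = B - εB², and B² is positive semidefinite. -/
theorem sum_sq_ridge_le (hε : 0 < ε) (j : Fin p) :
    ∑ k, (X * ridgeInv ε X) k j ^ 2 ≤ ridgeInv ε X j j := by
  have h := congrFun₂ (gram_mul_ridge X hε) j j
  have h' : ∑ k, (X * ridgeInv ε X) k j ^ 2 =
      ((X * ridgeInv ε X)ᵀ * (X * ridgeInv ε X)) j j := by
    rw [Matrix.mul_apply]
    simp [pow_two]
  rw [h', h, Matrix.sub_apply, Matrix.smul_apply, smul_eq_mul]
  have := (posSemidef_ridgeInv_sq (ε := ε) X).diag_nonneg (i := j)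
  nlinarith

theorem ridgeInv_trace_nonneg (hε : 0 < ε) : 0 ≤ (ridgeInv ε X).trace :=
  (posSemidef_ridgeInv X hε).trace_nonneg

theorem trace_ridge_gram (hε : 0 < ε) :
    (X * ridgeInv ε X * Xᵀ).trace = p - ε * (ridgeInv ε X).trace := by
  rw [Matrix.trace_mul_comm, ← Matrix.mul_assoc, gram_mul_ridgeInv X hε]
  simp [Matrix.trace_sub, Matrix.trace_smul]

theorem mul_trace_ridgeInv_le (hε : 0 < ε) : ε * (ridgeInv ε X).trace ≤ p := by
  have h : 0 ≤ (X * ridgeInv ε X * Xᵀ).trace := by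
    simpa using ((posSemidef_ridgeInv X hε).mul_mul_conjTranspose_same X).trace_nonneg
  rw [trace_ridge_gram X hε] at h
  linarith

theorem abs_ridgeInv_le_trace (hε : 0 < ε) (i j : Fin p) :
    |ridgeInv ε X i j| ≤ (ridgeInv ε X).trace :=
  (posSemidef_ridgeInv X hε).abs_apply_le_trace i j

theorem sq_ridge_le_trace (hε : 0 < ε) (k : Fin n) (j : Fin p) :
    (X * ridgeInv ε X) k j ^ 2 ≤ (ridgeInv ε X).trace :=
  ((Finset.single_le_sum (f := fun k => (X * ridgeInv ε X) k j ^ 2)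
    (fun _ _ => sq_nonneg _) (Finset.mem_univ k)).trans (sum_sq_ridge_le X hε j)).trans
    ((le_abs_self _).trans (abs_ridgeInv_le_trace X hε j j))

theorem mul_abs_ridgeInv_sq_le (hε : 0 < ε) (i j : Fin p) :
    ε * |(ridgeInv ε X * ridgeInv ε X) i j| ≤ (ridgeInv ε X).trace := by
  have h1 := (posSemidef_ridgeInv_sq (ε := ε) X).abs_apply_le_trace i j
  have h2 : 0 ≤ ((X * ridgeInv ε X)ᵀ * (X * ridgeInv ε X)).trace :=
    (posSemidef_gram (X * ridgeInv ε X)).trace_nonneg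
  rw [gram_mul_ridge X hε, Matrix.trace_sub, Matrix.trace_smul, smul_eq_mul] at h2
  nlinarith

/-- A kernel vector v of S satisfies v = εBv. Bounding the entries of B by tr B and summing |v_i|
over i forces tr B ≥ 1/(εp). -/
theorem one_le_of_not_isUnit_gram (hε : 0 < ε) (h : ¬ IsUnit (Xᵀ * X)) :
    1 ≤ ε * (p * (ridgeInv ε X).trace) := by
  rw [Matrix.isUnit_iff_isUnit_det, isUnit_iff_ne_zero, not_not,
    ← Matrix.exists_mulVec_eq_zero_iff] at h
  obtain ⟨v, hv, hSv⟩ := h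
  have h1 : v = ε • (ridgeInv ε X *ᵥ v) := by
    have := congrArg (· *ᵥ v) (ridgeInv_mul_gram X hε)
    simp only [← Matrix.mulVec_mulVec, hSv, Matrix.mulVec_zero, Matrix.sub_mulVec,
      Matrix.one_mulVec, Matrix.smul_mulVec] at this
    exact sub_eq_zero.1 this.symm
  have hpos : 0 < ∑ j, |v j| := by
    obtain ⟨i, hi⟩ := Function.ne_iff.1 hv
    exact Finset.sum_pos' (fun _ _ => abs_nonneg _) ⟨i, Finset.mem_univ i, abs_pos.2 hi⟩
  have h2 : ∀ i, |v i| ≤ ε * ((ridgeInv ε X).trace * ∑ j, |v j|) := fun i => by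
    conv_lhs => rw [h1]
    rw [Pi.smul_apply, smul_eq_mul, abs_mul, abs_of_pos hε]
    refine mul_le_mul_of_nonneg_left ?_ hε.le
    rw [Matrix.mulVec, dotProduct, Finset.mul_sum]
    refine (Finset.abs_sum_le_sum_abs _ _).trans (Finset.sum_le_sum fun j _ => ?_)
    rw [abs_mul]
    exact mul_le_mul_of_nonneg_right (abs_ridgeInv_le_trace X hε i j) (abs_nonneg _)
  have h3 := Finset.sum_le_sum fun i (_ : i ∈ Finset.univ) => h2 i
  rw [Finset.sum_const, Finset.card_univ, Fintype.card_fin, nsmul_eq_mul] at h3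
  by_contra! hlt
  nlinarith

/-- With T = S⁻¹, the resolvent identities T - B = εBT = εTB combine into T - B = εB² + ε²BTB, whose
terms have nonnegative trace. -/
theorem trace_ridgeInv_le (hε : 0 < ε) (h : IsUnit (Xᵀ * X)) :
    (ridgeInv ε X).trace ≤ (Xᵀ * X)⁻¹.trace := by
  have hu := (Matrix.isUnit_iff_isUnit_det _).1 h
  set B := ridgeInv ε X with hB
  set T := (Xᵀ * X)⁻¹ with hT
  have h1 : T - B = ε • (B * T) := by
    have := congrArg (· * T) (ridgeInv_mul_gram X hε)
    simp only [Matrix.mul_assoc, sub_mul, one_mul, smul_mul_assoc] at this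
    rw [← Matrix.mul_assoc Xᵀ, hT, Matrix.mul_nonsing_inv _ hu, mul_one, ← hT, ← hB] at this
    nth_rewrite 1 [this]
    rw [sub_sub_cancel]
  have h1' : T - B = ε • (T * B) := by
    have := congrArg (T * ·) (gram_mul_ridgeInv X hε)
    simp only [mul_sub, mul_one, mul_smul_comm] at this
    rw [← Matrix.mul_assoc, hT, Matrix.nonsing_inv_mul _ hu, one_mul, ← hT, ← hB] at this
    nth_rewrite 1 [this]
    rw [sub_sub_cancel]
  have h2 : T - B = ε • (B * B) + (ε * ε) • (B * T * B) := by
    have h3 : T = B + ε • (T * B) := by rw [← h1']; abel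
    calc T - B = ε • (B * T) := h1
      _ = ε • (B * (B + ε • (T * B))) := by rw [← h3]
      _ = _ := by
        rw [mul_add, smul_add, mul_smul_comm, smul_smul, Matrix.mul_assoc]
  have hTp : T.PosSemidef := (posSemidef_gram X).inv
  have h4 : 0 ≤ (B * T * B).trace := by
    have := (hTp.mul_mul_conjTranspose_same B).trace_nonneg
    simpa [hB, transpose_ridgeInv] using this
  have h5 : 0 ≤ (B * B).trace := (posSemidef_ridgeInv_sq X).trace_nonneg
  have h6 := congrArg Matrix.trace h2
  simp only [Matrix.trace_sub, Matrix.trace_add, Matrix.trace_smul, smul_eq_mul] at h6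
  nlinarith [mul_nonneg hε.le h5, mul_nonneg (mul_pos hε hε).le h4]

theorem tendsto_ridgeInv (h : IsUnit (Xᵀ * X)) :
    Filter.Tendsto (fun ε => ridgeInv ε X) (nhds 0) (nhds (Xᵀ * X)⁻¹) := by
  have hu := (Matrix.isUnit_iff_isUnit_det _).1 h
  have h1 : ContinuousAt Inv.inv (Xᵀ * X) := by
    refine continuousAt_matrix_inv _ ?_
    have : (Ring.inverse : ℝ → ℝ) = Inv.inv := funext fun x => Ring.inverse_eq_inv x
    rw [this]
    exact continuousAt_inv₀ hu.ne_zero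
  refine h1.tendsto.comp ?_
  have : Continuous fun ε : ℝ => Xᵀ * X + ε • (1 : Matrix (Fin p) (Fin p) ℝ) := by fun_prop
  simpa using this.tendsto 0

theorem hasDerivAt_gram_add (E : Matrix (Fin n) (Fin p) ℝ) (a b : Fin p) :
    HasDerivAt (fun t : ℝ => ((X + t • E)ᵀ * (X + t • E) +
      ε • (1 : Matrix (Fin p) (Fin p) ℝ)) a b) ((Eᵀ * X + Xᵀ * E) a b) 0 := by
  have h : (fun t : ℝ => ((X + t • E)ᵀ * (X + t • E) +
      ε • (1 : Matrix (Fin p) (Fin p) ℝ)) a b) = fun t => (Xᵀ * X + ε • 1 : Matrix _ _ ℝ) a b +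
        (t * (Eᵀ * X + Xᵀ * E) a b + t ^ 2 * (Eᵀ * E) a b) := by
    funext t
    simp only [Matrix.transpose_add, Matrix.transpose_smul, Matrix.add_mul, Matrix.mul_add,
      Matrix.smul_mul, Matrix.mul_smul, Matrix.add_apply, Matrix.smul_apply, smul_eq_mul]
    ring
  rw [h]
  have h1 := ((hasDerivAt_id' (0 : ℝ)).mul_const ((Eᵀ * X + Xᵀ * E) a b)).fun_add
    (((hasDerivAt_id' (0 : ℝ)).fun_pow 2).mul_const ((Eᵀ * E) a b))
  exact (h1.const_add _).congr_deriv (by simp)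

/-- Product rule for XB in the direction E = e_k e_iᵀ, with dB = -B(EᵀX + XᵀE)B; the two summands of
dB give the two subtracted terms. -/
theorem hasDerivAt_ridge_apply (hε : 0 < ε) (k : Fin n) (i j : Fin p) :
    HasDerivAt (fun t : ℝ => ((X + t • Matrix.single k i (1 : ℝ)) *
        ridgeInv ε (X + t • Matrix.single k i (1 : ℝ))) k j)
      (ridgeInv ε X i j - (X * ridgeInv ε X) k i * (X * ridgeInv ε X) k j -
        (X * ridgeInv ε X * Xᵀ) k k * ridgeInv ε X i j) 0 := by
  set E : Matrix (Fin n) (Fin p) ℝ := Matrix.single k i (1 : ℝ) with hE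
  have hB : ∀ a, HasDerivAt (fun t : ℝ => ridgeInv ε (X + t • E) a j)
      (-(ridgeInv ε X * (Eᵀ * X + Xᵀ * E) * ridgeInv ε X) a j) 0 := fun a => by
    have := hasDerivAt_matrix_inv
      (A := fun t => (X + t • E)ᵀ * (X + t • E) + ε • (1 : Matrix (Fin p) (Fin p) ℝ))
      (A' := fun _ => Eᵀ * X + Xᵀ * E) (t := 0) (hasDerivAt_gram_add X E)
      (isUnit_gram_add _ hε) a j
    simp only [zero_smul, add_zero] at this
    exact this
  have hX : ∀ a, HasDerivAt (fun t : ℝ => (X + t • E) k a) (E k a) 0 := fun a =>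
    (((hasDerivAt_id' (0 : ℝ)).mul_const (E k a)).const_add (X k a)).congr_deriv (one_mul _)
  have h := HasDerivAt.fun_sum fun a (_ : a ∈ Finset.univ) => (hX a).fun_mul (hB a)
  simp only [Matrix.mul_apply (M := X + _)]
  refine h.congr_deriv ?_
  simp only [zero_smul, add_zero, mul_neg, Finset.sum_add_distrib, Finset.sum_neg_distrib]
  rw [← Matrix.mul_apply, ← Matrix.mul_apply]
  have e1 : (E * ridgeInv ε X) k j = ridgeInv ε X i j := by simp [hE]
  have e2 : X * (ridgeInv ε X * (Eᵀ * X + Xᵀ * E) * ridgeInv ε X) =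
      (X * ridgeInv ε X) * Eᵀ * (X * ridgeInv ε X) +
        (X * ridgeInv ε X * Xᵀ) * (E * ridgeInv ε X) := by
    simp only [mul_add, add_mul, Matrix.mul_add, Matrix.mul_assoc]
  have e3 : ((X * ridgeInv ε X) * Eᵀ * (X * ridgeInv ε X)) k j =
      (X * ridgeInv ε X) k i * (X * ridgeInv ε X) k j := by
    rw [hE, Matrix.transpose_single, Matrix.mul_apply]
    rw [Finset.sum_eq_single k]
    · simp
    · intro b _ hb
      rw [Matrix.mul_single_apply_of_ne _ _ _ _ _ hb, zero_mul]
    · simp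
  have e4 : ((X * ridgeInv ε X * Xᵀ) * (E * ridgeInv ε X)) k j =
      (X * ridgeInv ε X * Xᵀ) k k * ridgeInv ε X i j := by
    rw [Matrix.mul_apply, Finset.sum_eq_single k]
    · rw [e1]
    · intro b _ hb
      rw [hE, Matrix.single_mul_apply_of_ne _ _ _ _ _ hb, mul_zero]
    · simp
  rw [e1, e2, Matrix.add_apply, e3, e4]
  ring

/-- The three terms sum to nB, (XB)ᵀ(XB) = B - εB² and tr(XBXᵀ)B = (p - ε tr B)B: this is the source
of n - p - 1. -/
theorem sum_ridge_deriv (hε : 0 < ε) (i j : Fin p) :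
    ∑ k, (ridgeInv ε X i j - (X * ridgeInv ε X) k i * (X * ridgeInv ε X) k j -
        (X * ridgeInv ε X * Xᵀ) k k * ridgeInv ε X i j) =
      ((n : ℝ) - p - 1) * ridgeInv ε X i j + ε * (ridgeInv ε X * ridgeInv ε X) i j +
        ε * (ridgeInv ε X).trace * ridgeInv ε X i j := by
  have h1 := congrFun₂ (gram_mul_ridge X hε) i j
  rw [Matrix.mul_apply] at h1
  have h2 := trace_ridge_gram X hε
  rw [Matrix.trace] at h2
  simp only [Matrix.transpose_apply, Matrix.diag_apply, Matrix.sub_apply, Matrix.smul_apply,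
    smul_eq_mul] at h1 h2
  rw [Finset.sum_sub_distrib, Finset.sum_sub_distrib, h1, ← Finset.sum_mul, h2]
  simp
  ring

end Ridge

/-! ### Gaussian moments and measurability -/

instance instBorelSpaceMatrix {n p : ℕ} : BorelSpace (Matrix (Fin n) (Fin p) ℝ) :=
  inferInstanceAs (BorelSpace (Fin n → Fin p → ℝ))

instance instSecondCountableTopologyMatrix {n p : ℕ} :
    SecondCountableTopology (Matrix (Fin n) (Fin p) ℝ) :=
  inferInstanceAs (SecondCountableTopology (Fin n → Fin p → ℝ))

section Moments

variable {n p : ℕ} (M : Matrix (Fin n) (Fin p) ℝ)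

theorem measurable_matrix_apply (k : Fin n) (j : Fin p) :
    Measurable fun X : Matrix (Fin n) (Fin p) ℝ => X k j :=
  (Continuous.matrix_elem continuous_id k j).measurable

theorem measurePreserving_matrix_apply (k : Fin n) (j : Fin p) :
    MeasurePreserving (fun X : Matrix (Fin n) (Fin p) ℝ => X k j) (matrixNormal M)
      (gaussianReal (M k j) 1) := by
  have : ∀ i : Fin n, IsProbabilityMeasure (Measure.pi fun j : Fin p => gaussianReal (M i j) 1) :=
    fun _ => inferInstance
  exact (measurePreserving_eval (fun j : Fin p => gaussianReal (M k j) 1) j).comp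
    (measurePreserving_eval (fun i : Fin n => Measure.pi fun j : Fin p => gaussianReal (M i j) 1) k)

theorem memLp_sub_apply (k : Fin n) (j : Fin p) :
    MemLp (fun X : Matrix (Fin n) (Fin p) ℝ => X k j - M k j) 2 (matrixNormal M) :=
  ((memLp_id_gaussianReal' (μ := M k j) (v := 1) 2 (by simp)).comp_measurePreserving
    (measurePreserving_matrix_apply M k j)).sub (memLp_const _)

/-- Stein's identity for the linear function X_kj - M_kj, whose derivative along entry (k, i) is
δ_ij. -/
theorem integral_sub_apply_mul_sub_apply (k : Fin n) (i j : Fin p) :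
    ∫ X : Matrix (Fin n) (Fin p) ℝ, (X k i - M k i) * (X k j - M k j) ∂(matrixNormal M) =
      (1 : Matrix (Fin p) (Fin p) ℝ) i j := by
  rw [stein_matrixNormal M k i (g := fun X => X k j - M k j)
    (g' := fun _ => (1 : Matrix (Fin p) (Fin p) ℝ) i j) (fun X => ?_)
    ((memLp_sub_apply M k j).integrable one_le_two) (integrable_const _)
    ((memLp_sub_apply M k i).integrable_mul (memLp_sub_apply M k j))]
  · simp
  · have h := ((((hasDerivAt_id' (0 : ℝ)).mul_const ((Matrix.single k i (1 : ℝ)) k j)).const_add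
      (X k j)).sub_const (M k j))
    refine h.congr_deriv ?_
    simp [Matrix.single_apply, Matrix.one_apply]

theorem integrable_sub_apply_sq (k : Fin n) (j : Fin p) :
    Integrable (fun X : Matrix (Fin n) (Fin p) ℝ => (X k j - M k j) ^ 2) (matrixNormal M) :=
  (memLp_sub_apply M k j).integrable_sq

theorem integral_sub_apply_sq (k : Fin n) (j : Fin p) :
    ∫ X : Matrix (Fin n) (Fin p) ℝ, (X k j - M k j) ^ 2 ∂(matrixNormal M) = 1 := by
  simpa [pow_two] using integral_sub_apply_mul_sub_apply M k j j

theorem measurable_matrix_inv_apply (i j : Fin p) :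
    Measurable fun A : Matrix (Fin p) (Fin p) ℝ => A⁻¹ i j := by
  simp only [Matrix.inv_def, Matrix.smul_apply, Ring.inverse_eq_inv, smul_eq_mul]
  have h1 : Continuous fun A : Matrix (Fin p) (Fin p) ℝ => A.det := continuous_id.matrix_det
  have h2 : Continuous fun A : Matrix (Fin p) (Fin p) ℝ => A.adjugate i j :=
    continuous_id.matrix_adjugate.matrix_elem i j
  exact h1.measurable.inv.mul h2.measurable

theorem measurable_ridgeInv_apply (ε : ℝ) (i j : Fin p) :
    Measurable fun X : Matrix (Fin n) (Fin p) ℝ => ridgeInv ε X i j := by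
  have h : Continuous fun X : Matrix (Fin n) (Fin p) ℝ =>
    Xᵀ * X + ε • (1 : Matrix (Fin p) (Fin p) ℝ) := by fun_prop
  exact (measurable_matrix_inv_apply i j).comp h.measurable

theorem measurable_ridgeInv_trace (ε : ℝ) :
    Measurable fun X : Matrix (Fin n) (Fin p) ℝ => (ridgeInv ε X).trace :=
  Finset.measurable_sum _ fun i _ => measurable_ridgeInv_apply ε i i

theorem measurable_ridge_apply (ε : ℝ) (k : Fin n) (j : Fin p) :
    Measurable fun X : Matrix (Fin n) (Fin p) ℝ => (X * ridgeInv ε X) k j := by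
  simp only [Matrix.mul_apply]
  exact Finset.measurable_sum _ fun a _ =>
    (measurable_matrix_apply k a).mul (measurable_ridgeInv_apply ε a j)

theorem measurable_invGram_apply (i j : Fin p) :
    Measurable fun X : Matrix (Fin n) (Fin p) ℝ => (Xᵀ * X)⁻¹ i j := by
  -- Measurability of the ridge inverse needs no positivity, and ε = 0 is the unregularised inverse.
  have := measurable_ridgeInv_apply (n := n) 0 i j
  simpa [ridgeInv] using this

theorem measurable_mul_invGram_apply (k : Fin n) (j : Fin p) :
    Measurable fun X : Matrix (Fin n) (Fin p) ℝ => (X * (Xᵀ * X)⁻¹) k j := by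
  have := measurable_ridge_apply (n := n) 0 k j
  simpa [ridgeInv] using this

end Moments

/-! ### Stein's identity at fixed ε and bounds uniform in ε -/

section RidgeStein

variable {n p : ℕ} (M : Matrix (Fin n) (Fin p) ℝ) {ε : ℝ}

theorem trace_ridgeInv_le_div (hε : 0 < ε) (X : Matrix (Fin n) (Fin p) ℝ) :
    (ridgeInv ε X).trace ≤ p / ε := by
  rw [le_div_iff₀ hε, mul_comm]
  exact mul_trace_ridgeInv_le X hε

theorem integrable_ridgeInv_trace (hε : 0 < ε) :
    Integrable (fun X => (ridgeInv ε X).trace) (matrixNormal M) := by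
  refine Integrable.of_bound (measurable_ridgeInv_trace ε).aestronglyMeasurable (p / ε)
    (Filter.Eventually.of_forall fun X => ?_)
  rw [Real.norm_eq_abs, abs_of_nonneg (ridgeInv_trace_nonneg X hε)]
  exact trace_ridgeInv_le_div hε X

theorem integrable_ridgeInv_apply (hε : 0 < ε) (i j : Fin p) :
    Integrable (fun X => ridgeInv ε X i j) (matrixNormal M) :=
  (integrable_ridgeInv_trace M hε).mono' (measurable_ridgeInv_apply ε i j).aestronglyMeasurable
    (Filter.Eventually.of_forall fun X => abs_ridgeInv_le_trace X hε i j)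

theorem memLp_ridge_apply (hε : 0 < ε) (k : Fin n) (j : Fin p) :
    MemLp (fun X => (X * ridgeInv ε X) k j) 2 (matrixNormal M) := by
  rw [memLp_two_iff_integrable_sq (measurable_ridge_apply ε k j).aestronglyMeasurable]
  refine (integrable_ridgeInv_trace M hε).mono'
    ((measurable_ridge_apply ε k j).pow_const 2).aestronglyMeasurable
    (Filter.Eventually.of_forall fun X => ?_)
  rw [Real.norm_eq_abs, abs_of_nonneg (sq_nonneg _)]
  exact sq_ridge_le_trace X hε k j

theorem integrable_ridge_leverage (hε : 0 < ε) (k : Fin n) (i j : Fin p) :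
    Integrable (fun X => (X * ridgeInv ε X * Xᵀ) k k * ridgeInv ε X i j) (matrixNormal M) := by
  have hm : Measurable fun X : Matrix (Fin n) (Fin p) ℝ => (X * ridgeInv ε X * Xᵀ) k k := by
    simp only [Matrix.mul_apply (N := _ᵀ), Matrix.transpose_apply]
    exact Finset.measurable_sum _ fun a _ =>
      (measurable_ridge_apply ε k a).mul (measurable_matrix_apply k a)
  refine ((integrable_ridgeInv_trace M hε).const_mul (p : ℝ)).mono'
    (hm.mul (measurable_ridgeInv_apply ε i j)).aestronglyMeasurable
    (Filter.Eventually.of_forall fun X => ?_)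
  have hps : (X * ridgeInv ε X * Xᵀ).PosSemidef := by
    simpa using (posSemidef_ridgeInv X hε).mul_mul_conjTranspose_same X
  have h1 : |(X * ridgeInv ε X * Xᵀ) k k| ≤ p := by
    refine (hps.abs_apply_le_trace k k).trans ?_
    rw [trace_ridge_gram X hε]
    have := mul_nonneg hε.le (ridgeInv_trace_nonneg X hε)
    linarith
  rw [Real.norm_eq_abs, abs_mul]
  exact mul_le_mul h1 (abs_ridgeInv_le_trace X hε i j) (abs_nonneg _) (Nat.cast_nonneg _)

theorem integrable_sub_mul_ridge (hε : 0 < ε) (k : Fin n) (i j : Fin p) :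
    Integrable (fun X => (X k i - M k i) * (X * ridgeInv ε X) k j) (matrixNormal M) :=
  (memLp_sub_apply M k i).integrable_mul (memLp_ridge_apply M hε k j)

/-- Stein's identity for the regularised estimator. -/
theorem integral_sum_sub_mul_ridge (hε : 0 < ε) (i j : Fin p) :
    ∫ X, ∑ k, (X k i - M k i) * (X * ridgeInv ε X) k j ∂(matrixNormal M) =
      ∫ X : Matrix (Fin n) (Fin p) ℝ, (((n : ℝ) - p - 1) * ridgeInv ε X i j +
        ε * (ridgeInv ε X * ridgeInv ε X) i j +
        ε * (ridgeInv ε X).trace * ridgeInv ε X i j) ∂(matrixNormal M) := by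
  have hD : ∀ k, Integrable (fun X => ridgeInv ε X i j -
      (X * ridgeInv ε X) k i * (X * ridgeInv ε X) k j -
        (X * ridgeInv ε X * Xᵀ) k k * ridgeInv ε X i j) (matrixNormal M) := fun k =>
    ((integrable_ridgeInv_apply M hε i j).sub
      ((memLp_ridge_apply M hε k i).integrable_mul (memLp_ridge_apply M hε k j))).sub
        (integrable_ridge_leverage M hε k i j)
  simp only [← sum_ridge_deriv _ hε]
  rw [integral_finsetSum _ fun k _ => hD k,
    integral_finsetSum _ fun k _ => integrable_sub_mul_ridge M hε k i j]
  exact Finset.sum_congr rfl fun k _ => stein_matrixNormal M k i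
    (fun X => hasDerivAt_ridge_apply X hε k i j)
    ((memLp_ridge_apply M hε k j).integrable one_le_two) (hD k)
    (integrable_sub_mul_ridge M hε k i j)

/-- The constants come from |B_ij| ≤ tr B, ε|(B²)_ij| ≤ tr B and ε tr B ≤ p; none depends on ε. -/
theorem abs_ridge_sum_le (hε : 0 < ε) {d : ℝ} (hd : 0 ≤ d) (X : Matrix (Fin n) (Fin p) ℝ)
    (i j : Fin p) :
    |d * ridgeInv ε X i j + ε * (ridgeInv ε X * ridgeInv ε X) i j +
        ε * (ridgeInv ε X).trace * ridgeInv ε X i j| ≤ (d + 1 + p) * (ridgeInv ε X).trace := by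
  have h1 := abs_ridgeInv_le_trace X hε i j
  have h2 := mul_abs_ridgeInv_sq_le X hε i j
  have h3 := mul_trace_ridgeInv_le X hε
  have h4 := ridgeInv_trace_nonneg X hε
  refine (abs_add_three _ _ _).trans ?_
  rw [abs_mul, abs_mul, abs_mul, abs_of_nonneg hd, abs_of_pos hε,
    abs_of_nonneg (mul_nonneg hε.le h4)]
  have h5 := mul_le_mul_of_nonneg_left h1 hd
  have h6 := mul_le_mul h3 h1 (abs_nonneg _) (Nat.cast_nonneg _)
  linarith

theorem measurable_ridge_sum (d : ℝ) (i j : Fin p) :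
    Measurable fun X : Matrix (Fin n) (Fin p) ℝ => d * ridgeInv ε X i j +
      ε * (ridgeInv ε X * ridgeInv ε X) i j + ε * (ridgeInv ε X).trace * ridgeInv ε X i j := by
  have h : Measurable fun X : Matrix (Fin n) (Fin p) ℝ => (ridgeInv ε X * ridgeInv ε X) i j := by
    simp only [Matrix.mul_apply]
    exact Finset.measurable_sum _ fun a _ =>
      (measurable_ridgeInv_apply ε i a).mul (measurable_ridgeInv_apply ε a j)
  exact (((measurable_ridgeInv_apply ε i j).const_mul d).add (h.const_mul ε)).add
    (((measurable_ridgeInv_trace ε).const_mul ε).mul (measurable_ridgeInv_apply ε i j))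

theorem integrable_ridge_sum (hε : 0 < ε) {d : ℝ} (hd : 0 ≤ d) (i j : Fin p) :
    Integrable (fun X => d * ridgeInv ε X i j + ε * (ridgeInv ε X * ridgeInv ε X) i j +
        ε * (ridgeInv ε X).trace * ridgeInv ε X i j) (matrixNormal M) :=
  ((integrable_ridgeInv_trace M hε).const_mul (d + 1 + p)).mono'
    (measurable_ridge_sum d i j).aestronglyMeasurable
    (Filter.Eventually.of_forall fun X => abs_ridge_sum_le hε hd X i j)

/-- A bound on the expected regularised inverse that does not depend on the regularisation. -/
theorem integral_ridgeInv_apply_le (hε : 0 < ε) (hd : 0 < (n : ℝ) - p - 1) (j : Fin p) :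
    ∫ X, ridgeInv ε X j j ∂(matrixNormal M) ≤ n / ((n : ℝ) - p - 1) ^ 2 := by
  have hs := integral_sum_sub_mul_ridge M hε j j
  set d : ℝ := (n : ℝ) - p - 1
  -- On the diagonal both ε-terms of the divergence are nonnegative and are dropped.
  have h1 : ∫ X, d * ridgeInv ε X j j ∂(matrixNormal M) ≤
      ∫ X, ∑ k, (X k j - M k j) * (X * ridgeInv ε X) k j ∂(matrixNormal M) := by
    rw [hs]
    refine integral_mono ((integrable_ridgeInv_apply M hε j j).const_mul d)
      (integrable_ridge_sum M hε hd.le j j) fun X => ?_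
    have h2 := (posSemidef_ridgeInv_sq (ε := ε) X).diag_nonneg (i := j)
    have h3 := (posSemidef_ridgeInv X hε).diag_nonneg (i := j)
    have h4 := ridgeInv_trace_nonneg X hε
    have h5 := mul_nonneg hε.le h2
    have h6 := mul_nonneg (mul_nonneg hε.le h4) h3
    simp only
    linarith
  have hI : Integrable (fun X => ∑ k, (X k j - M k j) ^ 2) (matrixNormal M) :=
    integrable_finsetSum _ fun k _ => integrable_sub_apply_sq M k j
  -- Young's inequality ab ≤ a²/(2d) + db²/2, weighted so that the quadratic term costs at most
  -- (d/2) E B_jj, half of what `h1` provides.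
  have h2 : ∫ X, ∑ k, (X k j - M k j) * (X * ridgeInv ε X) k j ∂(matrixNormal M) ≤
      ∫ X, ((2 * d)⁻¹ * ∑ k, (X k j - M k j) ^ 2 + d / 2 * ridgeInv ε X j j)
        ∂(matrixNormal M) := by
    refine integral_mono (integrable_finsetSum _ fun k _ => integrable_sub_mul_ridge M hε k j j)
      ((hI.const_mul _).add ((integrable_ridgeInv_apply M hε j j).const_mul _)) fun X => ?_
    have h3 : ∀ k, (X k j - M k j) * (X * ridgeInv ε X) k j ≤
        (2 * d)⁻¹ * (X k j - M k j) ^ 2 + d / 2 * (X * ridgeInv ε X) k j ^ 2 := fun k => by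
      have : (2 * d)⁻¹ * (X k j - M k j) ^ 2 + d / 2 * (X * ridgeInv ε X) k j ^ 2 -
          (X k j - M k j) * (X * ridgeInv ε X) k j =
          (2 * d)⁻¹ * ((X k j - M k j) - d * (X * ridgeInv ε X) k j) ^ 2 := by
        field_simp
        ring
      have h0 : 0 ≤ (2 * d)⁻¹ * ((X k j - M k j) - d * (X * ridgeInv ε X) k j) ^ 2 := by
        positivity
      linarith
    refine (Finset.sum_le_sum fun k _ => h3 k).trans ?_
    rw [Finset.sum_add_distrib, ← Finset.mul_sum, ← Finset.mul_sum]
    gcongr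
    exact sum_sq_ridge_le X hε j
  rw [integral_add (hI.const_mul _) ((integrable_ridgeInv_apply M hε j j).const_mul _),
    integral_const_mul, integral_const_mul, integral_finsetSum _
    fun k _ => integrable_sub_apply_sq M k j] at h2
  simp only [integral_sub_apply_sq, Finset.sum_const, Finset.card_univ, Fintype.card_fin,
    nsmul_eq_mul, mul_one] at h2
  rw [integral_const_mul] at h1
  rw [le_div_iff₀ (by positivity)]
  have h3 := h1.trans h2
  have h4 : (2 * d)⁻¹ * n * (2 * d) = n := by field_simp
  nlinarith

theorem integral_ridgeInv_trace_le (hε : 0 < ε) (hd : 0 < (n : ℝ) - p - 1) :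
    ∫ X, (ridgeInv ε X).trace ∂(matrixNormal M) ≤ p * (n / ((n : ℝ) - p - 1) ^ 2) := by
  simp only [Matrix.trace, Matrix.diag_apply]
  rw [integral_finsetSum _ fun j _ => integrable_ridgeInv_apply M hε j j]
  refine (Finset.sum_le_sum fun j _ => integral_ridgeInv_apply_le M hε hd j).trans ?_
  simp

end RidgeStein

/-! ### Removing the regularisation; the risk formula -/

section Limit

variable {n p : ℕ} (M : Matrix (Fin n) (Fin p) ℝ)

/-- A sequence of regularisation parameters tending to zero. -/
noncomputable def ridgeSeq (m : ℕ) : ℝ := 1 / ((m : ℝ) + 1)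

theorem ridgeSeq_pos (m : ℕ) : 0 < ridgeSeq m := Nat.one_div_pos_of_nat

theorem tendsto_ridgeSeq : Filter.Tendsto ridgeSeq Filter.atTop (nhds 0) :=
  tendsto_one_div_add_atTop_nhds_zero_nat

theorem tendsto_ridgeInv_apply {X : Matrix (Fin n) (Fin p) ℝ} (h : IsUnit (Xᵀ * X))
    (i j : Fin p) :
    Filter.Tendsto (fun m => ridgeInv (ridgeSeq m) X i j) Filter.atTop
      (nhds ((Xᵀ * X)⁻¹ i j)) :=
  ((Continuous.matrix_elem continuous_id i j).tendsto _).comp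
    ((tendsto_ridgeInv X h).comp tendsto_ridgeSeq)

theorem tendsto_ridgeInv_trace {X : Matrix (Fin n) (Fin p) ℝ} (h : IsUnit (Xᵀ * X)) :
    Filter.Tendsto (fun m => (ridgeInv (ridgeSeq m) X).trace) Filter.atTop
      (nhds (Xᵀ * X)⁻¹.trace) :=
  tendsto_finsetSum _ fun i _ => tendsto_ridgeInv_apply h i i

theorem tendsto_ridgeInv_trace_top {X : Matrix (Fin n) (Fin p) ℝ} (h : ¬ IsUnit (Xᵀ * X)) :
    Filter.Tendsto (fun m => (ridgeInv (ridgeSeq m) X).trace) Filter.atTop Filter.atTop := by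
  have hp : 0 < (p : ℝ) := by
    have h1 := one_le_of_not_isUnit_gram X (ridgeSeq_pos 0) h
    rcases Nat.eq_zero_or_pos p with hp | hp
    · subst hp; norm_num at h1
    · exact_mod_cast hp
  have h0 : Filter.Tendsto (fun m : ℕ => ((m : ℝ) + 1) / p) Filter.atTop Filter.atTop :=
    (Filter.tendsto_atTop_add_const_right _ _ tendsto_natCast_atTop_atTop).atTop_div_const hp
  refine Filter.tendsto_atTop_mono (fun m => ?_) h0
  have h1 := one_le_of_not_isUnit_gram X (ridgeSeq_pos m) h
  rw [ridgeSeq, one_div_mul_eq_div, one_le_div (by positivity)] at h1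
  rwa [div_le_iff₀' hp]

/-- Fatou's lemma with the uniform bound on E tr B. The extended-valued liminf is ∞ at singular S
and tr S⁻¹ elsewhere, so finiteness settles both invertibility and integrability. -/
theorem lintegral_liminf_ridgeInv_trace_lt_top (hd : 0 < (n : ℝ) - p - 1) :
    ∫⁻ X, Filter.liminf (fun m => ENNReal.ofReal (ridgeInv (ridgeSeq m) X).trace) Filter.atTop
      ∂(matrixNormal M) < ∞ := by
  refine (lintegral_liminf_le fun m =>
    (measurable_ridgeInv_trace (ridgeSeq m)).ennreal_ofReal).trans_lt ?_
  refine lt_of_le_of_lt (b := ENNReal.ofReal (p * (n / ((n : ℝ) - p - 1) ^ 2))) ?_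
    ENNReal.ofReal_lt_top
  refine Filter.liminf_le_of_frequently_le' (Filter.Frequently.of_forall fun m => ?_)
  rw [← ofReal_integral_eq_lintegral_ofReal (integrable_ridgeInv_trace M (ridgeSeq_pos m))
    (Filter.Eventually.of_forall fun X => ridgeInv_trace_nonneg X (ridgeSeq_pos m))]
  exact ENNReal.ofReal_le_ofReal (integral_ridgeInv_trace_le M (ridgeSeq_pos m) hd)

/-- The Gram matrix is almost surely invertible. -/
theorem ae_isUnit_gram (hd : 0 < (n : ℝ) - p - 1) :
    ∀ᵐ X : Matrix (Fin n) (Fin p) ℝ ∂(matrixNormal M), IsUnit (Xᵀ * X) := by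
  have hm : Measurable fun X : Matrix (Fin n) (Fin p) ℝ =>
      Filter.liminf (fun m => ENNReal.ofReal (ridgeInv (ridgeSeq m) X).trace) Filter.atTop :=
    Measurable.liminf fun m => (measurable_ridgeInv_trace (ridgeSeq m)).ennreal_ofReal
  filter_upwards [ae_lt_top hm (lintegral_liminf_ridgeInv_trace_lt_top M hd).ne] with X hX
  by_contra h
  exact hX.ne (ENNReal.tendsto_ofReal_atTop.comp (tendsto_ridgeInv_trace_top h)).liminf_eq

theorem trace_invGram_nonneg (X : Matrix (Fin n) (Fin p) ℝ) : 0 ≤ (Xᵀ * X)⁻¹.trace :=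
  (posSemidef_gram X).inv.trace_nonneg

theorem integrable_invGram_trace (hd : 0 < (n : ℝ) - p - 1) :
    Integrable (fun X : Matrix (Fin n) (Fin p) ℝ => (Xᵀ * X)⁻¹.trace) (matrixNormal M) := by
  have hm : Measurable fun X : Matrix (Fin n) (Fin p) ℝ => (Xᵀ * X)⁻¹.trace :=
    Finset.measurable_sum _ fun i _ => measurable_invGram_apply i i
  refine ⟨hm.aestronglyMeasurable, ?_⟩
  rw [hasFiniteIntegral_iff_ofReal (Filter.Eventually.of_forall trace_invGram_nonneg)]
  refine lt_of_eq_of_lt (lintegral_congr_ae ?_) (lintegral_liminf_ridgeInv_trace_lt_top M hd)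
  filter_upwards [ae_isUnit_gram M hd] with X hX
  exact ((ENNReal.continuous_ofReal.tendsto _).comp (tendsto_ridgeInv_trace hX)).liminf_eq.symm

theorem integrable_invGram_apply (hd : 0 < (n : ℝ) - p - 1) (i j : Fin p) :
    Integrable (fun X : Matrix (Fin n) (Fin p) ℝ => (Xᵀ * X)⁻¹ i j) (matrixNormal M) :=
  (integrable_invGram_trace M hd).mono' (measurable_invGram_apply i j).aestronglyMeasurable
    (Filter.Eventually.of_forall fun X => (posSemidef_gram X).inv.abs_apply_le_trace i j)

theorem gram_mul_invGram {X : Matrix (Fin n) (Fin p) ℝ} (h : IsUnit (Xᵀ * X)) :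
    (X * (Xᵀ * X)⁻¹)ᵀ * (X * (Xᵀ * X)⁻¹) = (Xᵀ * X)⁻¹ := by
  have hu := (Matrix.isUnit_iff_isUnit_det _).1 h
  rw [Matrix.transpose_mul, Matrix.transpose_nonsing_inv, Matrix.transpose_mul,
    Matrix.transpose_transpose, Matrix.mul_assoc, ← Matrix.mul_assoc Xᵀ,
    Matrix.mul_nonsing_inv _ hu, Matrix.mul_one]

theorem sq_mul_invGram_le {X : Matrix (Fin n) (Fin p) ℝ} (h : IsUnit (Xᵀ * X)) (k : Fin n)
    (j : Fin p) : (X * (Xᵀ * X)⁻¹) k j ^ 2 ≤ (Xᵀ * X)⁻¹.trace := by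
  have h1 := congrFun₂ (gram_mul_invGram h) j j
  rw [Matrix.mul_apply] at h1
  have h2 : (X * (Xᵀ * X)⁻¹) k j ^ 2 ≤ ∑ k, (X * (Xᵀ * X)⁻¹) k j ^ 2 :=
    Finset.single_le_sum (f := fun k => (X * (Xᵀ * X)⁻¹) k j ^ 2)
      (fun _ _ => sq_nonneg _) (Finset.mem_univ k)
  simp only [Matrix.transpose_apply, ← pow_two] at h1
  rw [h1] at h2
  exact h2.trans ((le_abs_self _).trans ((posSemidef_gram X).inv.abs_apply_le_trace j j))

theorem memLp_mul_invGram_apply (hd : 0 < (n : ℝ) - p - 1) (k : Fin n) (j : Fin p) :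
    MemLp (fun X : Matrix (Fin n) (Fin p) ℝ => (X * (Xᵀ * X)⁻¹) k j) 2 (matrixNormal M) := by
  have hm := measurable_mul_invGram_apply (n := n) k j
  rw [memLp_two_iff_integrable_sq hm.aestronglyMeasurable]
  refine (integrable_invGram_trace M hd).mono' (hm.pow_const 2).aestronglyMeasurable ?_
  filter_upwards [ae_isUnit_gram M hd] with X hX
  rw [Real.norm_eq_abs, abs_of_nonneg (sq_nonneg _)]
  exact sq_mul_invGram_le hX k j

theorem tendsto_ridge_apply {X : Matrix (Fin n) (Fin p) ℝ} (h : IsUnit (Xᵀ * X)) (k : Fin n)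
    (j : Fin p) :
    Filter.Tendsto (fun m => (X * ridgeInv (ridgeSeq m) X) k j) Filter.atTop
      (nhds ((X * (Xᵀ * X)⁻¹) k j)) := by
  simp only [Matrix.mul_apply (M := X)]
  exact tendsto_finsetSum _ fun a _ => (tendsto_ridgeInv_apply h a j).const_mul _

theorem tendsto_ridge_sum {X : Matrix (Fin n) (Fin p) ℝ} (h : IsUnit (Xᵀ * X)) (d : ℝ)
    (i j : Fin p) :
    Filter.Tendsto (fun m => d * ridgeInv (ridgeSeq m) X i j +
      ridgeSeq m * (ridgeInv (ridgeSeq m) X * ridgeInv (ridgeSeq m) X) i j +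
      ridgeSeq m * (ridgeInv (ridgeSeq m) X).trace * ridgeInv (ridgeSeq m) X i j) Filter.atTop
      (nhds (d * (Xᵀ * X)⁻¹ i j)) := by
  have h1 : Filter.Tendsto (fun m => (ridgeInv (ridgeSeq m) X * ridgeInv (ridgeSeq m) X) i j)
      Filter.atTop (nhds (((Xᵀ * X)⁻¹ * (Xᵀ * X)⁻¹) i j)) := by
    simp only [Matrix.mul_apply (M := ridgeInv _ _), Matrix.mul_apply (M := (Xᵀ * X)⁻¹)]
    exact tendsto_finsetSum _ fun a _ =>
      (tendsto_ridgeInv_apply h i a).mul (tendsto_ridgeInv_apply h a j)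
  have h2 := (((tendsto_ridgeInv_apply h i j).const_mul d).add (tendsto_ridgeSeq.mul h1)).add
    ((tendsto_ridgeSeq.mul (tendsto_ridgeInv_trace h)).mul (tendsto_ridgeInv_apply h i j))
  simpa using h2

/-- Stein's identity for `X (Xᵀ X)⁻¹`. -/
theorem integral_sum_sub_mul_invGram (hd : 0 < (n : ℝ) - p - 1) (i j : Fin p) :
    ∫ X : Matrix (Fin n) (Fin p) ℝ, ∑ k, (X k i - M k i) * (X * (Xᵀ * X)⁻¹) k j
        ∂(matrixNormal M) =
      ((n : ℝ) - p - 1) * ∫ X : Matrix (Fin n) (Fin p) ℝ, (Xᵀ * X)⁻¹ i j ∂(matrixNormal M) := by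
  rw [← integral_const_mul]
  have hu := ae_isUnit_gram M hd
  have hT := integrable_invGram_trace M hd
  -- Both sides are limits of the ridge identity. On the left |ab| ≤ a² + b² with (XB)_kj² ≤ tr B ≤
  -- tr S⁻¹; on the right `abs_ridge_sum_le` supplies the domination.
  refine tendsto_nhds_unique (tendsto_integral_of_dominated_convergence
    (F := fun m X => ∑ k, (X k i - M k i) * (X * ridgeInv (ridgeSeq m) X) k j)
    (fun X => ∑ k, ((X k i - M k i) ^ 2 + (Xᵀ * X)⁻¹.trace)) (fun m => ?_)
    (integrable_finsetSum _ fun k _ => (integrable_sub_apply_sq M k i).add hT) (fun m => ?_) ?_) ?_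
  · exact (integrable_finsetSum _ fun k _ =>
      integrable_sub_mul_ridge M (ridgeSeq_pos m) k i j).aestronglyMeasurable
  · filter_upwards [hu] with X hX
    refine (Finset.abs_sum_le_sum_abs _ _).trans (Finset.sum_le_sum fun k _ => ?_)
    have h1 := (sq_ridge_le_trace X (ridgeSeq_pos m) k j).trans
      (trace_ridgeInv_le X (ridgeSeq_pos m) hX)
    rw [abs_le]
    constructor <;>
    nlinarith [sq_nonneg ((X k i - M k i) + (X * ridgeInv (ridgeSeq m) X) k j),
      sq_nonneg ((X k i - M k i) - (X * ridgeInv (ridgeSeq m) X) k j),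
      trace_invGram_nonneg X, sq_nonneg (X k i - M k i)]
  · filter_upwards [hu] with X hX
    exact tendsto_finsetSum _ fun k _ => (tendsto_ridge_apply hX k j).const_mul _
  · simp only [integral_sum_sub_mul_ridge M (ridgeSeq_pos _) i j]
    refine tendsto_integral_of_dominated_convergence
      (fun X => (((n : ℝ) - p - 1) + 1 + p) * (Xᵀ * X)⁻¹.trace) (fun m => ?_)
      (hT.const_mul _) (fun m => ?_) ?_
    · exact (integrable_ridge_sum M (ridgeSeq_pos m) hd.le i j).aestronglyMeasurable
    · filter_upwards [hu] with X hX
      refine (abs_ridge_sum_le (ridgeSeq_pos m) hd.le X i j).trans ?_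
      have := trace_ridgeInv_le X (ridgeSeq_pos m) hX
      gcongr
    · filter_upwards [hu] with X hX
      exact tendsto_ridge_sum hX _ i j

theorem matrixLoss_efronMorris_apply {X : Matrix (Fin n) (Fin p) ℝ} (hX : IsUnit (Xᵀ * X))
    (i j : Fin p) :
    matrixLoss M (efronMorris X) i j =
      ∑ k, (X k i - M k i) * (X k j - M k j) -
        ((n : ℝ) - p - 1) * ∑ k, (X k i - M k i) * (X * (Xᵀ * X)⁻¹) k j -
        ((n : ℝ) - p - 1) * ∑ k, (X k j - M k j) * (X * (Xᵀ * X)⁻¹) k i +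
        ((n : ℝ) - p - 1) ^ 2 * (Xᵀ * X)⁻¹ i j := by
  have h1 := congrFun₂ (gram_mul_invGram hX) i j
  rw [Matrix.mul_apply] at h1
  rw [← h1, matrixLoss, Matrix.mul_apply, Finset.mul_sum, Finset.mul_sum, Finset.mul_sum,
    ← Finset.sum_sub_distrib, ← Finset.sum_sub_distrib, ← Finset.sum_add_distrib]
  refine Finset.sum_congr rfl fun k _ => ?_
  have h2 : efronMorris X = X - ((n : ℝ) - p - 1) • (X * (Xᵀ * X)⁻¹) := by
    rw [efronMorris, Matrix.mul_sub, Matrix.mul_one, Matrix.mul_smul]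
  rw [h2]
  simp only [Matrix.transpose_apply, Matrix.sub_apply, Matrix.smul_apply, smul_eq_mul]
  ring

theorem integrable_sum_sub_mul_sub (i j : Fin p) :
    Integrable (fun X : Matrix (Fin n) (Fin p) ℝ => ∑ k, (X k i - M k i) * (X k j - M k j))
      (matrixNormal M) :=
  integrable_finsetSum _ fun k _ => (memLp_sub_apply M k i).integrable_mul (memLp_sub_apply M k j)

theorem integral_sum_sub_mul_sub (i j : Fin p) :
    ∫ X : Matrix (Fin n) (Fin p) ℝ, ∑ k, (X k i - M k i) * (X k j - M k j) ∂(matrixNormal M) =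
      n * (1 : Matrix (Fin p) (Fin p) ℝ) i j := by
  have h : ∀ k, Integrable (fun X : Matrix (Fin n) (Fin p) ℝ =>
      (X k i - M k i) * (X k j - M k j)) (matrixNormal M) := fun k =>
    (memLp_sub_apply M k i).integrable_mul (memLp_sub_apply M k j)
  rw [integral_finsetSum _ fun k _ => h k]
  simp [integral_sub_apply_mul_sub_apply]

theorem integrable_sum_sub_mul_invGram (hd : 0 < (n : ℝ) - p - 1) (i j : Fin p) :
    Integrable (fun X : Matrix (Fin n) (Fin p) ℝ =>
      ∑ k, (X k i - M k i) * (X * (Xᵀ * X)⁻¹) k j) (matrixNormal M) :=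
  integrable_finsetSum _ fun k _ =>
    (memLp_sub_apply M k i).integrable_mul (memLp_mul_invGram_apply M hd k j)

theorem integrable_matrixLoss_efronMorris (hd : 0 < (n : ℝ) - p - 1) (i j : Fin p) :
    Integrable (fun X => matrixLoss M (efronMorris X) i j) (matrixNormal M) := by
  have h := (((integrable_sum_sub_mul_sub M i j).sub
    ((integrable_sum_sub_mul_invGram M hd i j).const_mul ((n : ℝ) - p - 1))).sub
    ((integrable_sum_sub_mul_invGram M hd j i).const_mul ((n : ℝ) - p - 1))).add
    ((integrable_invGram_apply M hd i j).const_mul (((n : ℝ) - p - 1) ^ 2))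
  refine h.congr ?_
  filter_upwards [ae_isUnit_gram M hd] with X hX
  exact (matrixLoss_efronMorris_apply M hX i j).symm

theorem invGram_symm (X : Matrix (Fin n) (Fin p) ℝ) (i j : Fin p) :
    (Xᵀ * X)⁻¹ j i = (Xᵀ * X)⁻¹ i j := by
  simpa using (posSemidef_gram X).inv.1.apply i j

theorem integral_sub_sub_add {α : Type*} [MeasurableSpace α] {μ : Measure α} {f g h u : α → ℝ}
    (hf : Integrable f μ) (hg : Integrable g μ) (hh : Integrable h μ) (hu : Integrable u μ) :
    ∫ x, (f x - g x - h x + u x) ∂μ =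
      ∫ x, f x ∂μ - ∫ x, g x ∂μ - ∫ x, h x ∂μ + ∫ x, u x ∂μ := by
  have hfg : Integrable (fun x => f x - g x) μ := hf.sub hg
  have hfgh : Integrable (fun x => f x - g x - h x) μ := hfg.sub hh
  rw [integral_add hfgh hu, integral_sub hfg hh, integral_sub hf hg]

/-- The matrix quadratic risk of the Efron–Morris estimator. -/
theorem matrixRisk_efronMorris (hd : 0 < (n : ℝ) - p - 1) :
    matrixRisk M efronMorris = (n : ℝ) • (1 : Matrix (Fin p) (Fin p) ℝ) -
      ((n : ℝ) - p - 1) ^ 2 • expectedInvGram M := by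
  ext i j
  have h1 := integrable_sum_sub_mul_sub M i j
  have h2 := (integrable_sum_sub_mul_invGram M hd i j).const_mul ((n : ℝ) - p - 1)
  have h3 := (integrable_sum_sub_mul_invGram M hd j i).const_mul ((n : ℝ) - p - 1)
  have h4 := (integrable_invGram_apply M hd i j).const_mul (((n : ℝ) - p - 1) ^ 2)
  have h : matrixRisk M efronMorris i j = _ := (integral_congr_ae (by
    filter_upwards [ae_isUnit_gram M hd] with X hX
    exact matrixLoss_efronMorris_apply M hX i j)).trans (integral_sub_sub_add h1 h2 h3 h4)
  -- Each cross term contributes -d² E S⁻¹ (by symmetry of S⁻¹ for the transposed one), against +d²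
  -- E S⁻¹ from the quadratic term.
  rw [h, integral_const_mul, integral_const_mul, integral_const_mul,
    integral_sum_sub_mul_invGram M hd, integral_sum_sub_mul_invGram M hd,
    integral_sum_sub_mul_sub]
  simp only [invGram_symm _ i j, Matrix.sub_apply, Matrix.smul_apply,
    smul_eq_mul, expectedInvGram, Matrix.of_apply]
  ring

theorem posSemidef_expectedInvGram (hd : 0 < (n : ℝ) - p - 1) :
    (expectedInvGram M).PosSemidef := by
  refine Matrix.PosSemidef.of_dotProduct_mulVec_nonneg ?_ fun x => ?_
  · ext i j
    simp [expectedInvGram, invGram_symm _ i j]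
  · have hI : ∀ i j, Integrable (fun X : Matrix (Fin n) (Fin p) ℝ =>
        x i * ((Xᵀ * X)⁻¹ i j * x j)) (matrixNormal M) := fun i j =>
      ((integrable_invGram_apply M hd i j).mul_const _).const_mul _
    have h : x ⬝ᵥ (expectedInvGram M *ᵥ x) =
        ∫ X : Matrix (Fin n) (Fin p) ℝ, x ⬝ᵥ ((Xᵀ * X)⁻¹ *ᵥ x) ∂(matrixNormal M) := by
      simp only [dotProduct, Matrix.mulVec, Finset.mul_sum, expectedInvGram, Matrix.of_apply]
      rw [integral_finsetSum _ fun i _ => integrable_finsetSum _ fun j _ => hI i j]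
      refine Finset.sum_congr rfl fun i _ => ?_
      rw [integral_finsetSum _ fun j _ => hI i j]
      refine Finset.sum_congr rfl fun j _ => ?_
      rw [integral_const_mul, integral_mul_const]
    rw [star_trivial, h]
    exact integral_nonneg fun X => by
      simpa using (posSemidef_gram X).inv.dotProduct_mulVec_nonneg x

theorem posSemidef_sub_matrixRisk_efronMorris (hd : 0 < (n : ℝ) - p - 1) :
    ((n : ℝ) • (1 : Matrix (Fin p) (Fin p) ℝ) - matrixRisk M efronMorris).PosSemidef := by
  rw [matrixRisk_efronMorris M hd, sub_sub_cancel]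
  exact (posSemidef_expectedInvGram M hd).smul (sq_nonneg _)

theorem measurable_efronMorris :
    Measurable (efronMorris : Matrix (Fin n) (Fin p) ℝ → Matrix (Fin n) (Fin p) ℝ) := by
  refine measurable_pi_iff.2 fun k => measurable_pi_iff.2 fun j => ?_
  have h : (fun X : Matrix (Fin n) (Fin p) ℝ => efronMorris X k j) =
      fun X => X k j - ((n : ℝ) - p - 1) * (X * (Xᵀ * X)⁻¹) k j := by
    funext X
    rw [efronMorris, Matrix.mul_sub, Matrix.mul_one, Matrix.mul_smul]
    rfl
  exact h ▸ (measurable_matrix_apply k j).sub ((measurable_mul_invGram_apply k j).const_mul _)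

theorem directionalRisk_efronMorris_le (hd : 0 < (n : ℝ) - p - 1) (c : Fin p → ℝ) :
    directionalRisk M efronMorris c ≤ ENNReal.ofReal (n * (c ⬝ᵥ c)) := by
  rw [directionalRisk_eq M _ c (integrable_matrixLoss_efronMorris M hd)]
  refine ENNReal.ofReal_le_ofReal ?_
  have h := (posSemidef_sub_matrixRisk_efronMorris M hd).dotProduct_mulVec_nonneg c
  rw [star_trivial, Matrix.sub_mulVec, dotProduct_sub, Matrix.smul_mulVec, Matrix.one_mulVec,
    dotProduct_smul, smul_eq_mul] at h
  linarith

end Limit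

/-! ### Bayes lower bound and minimaxity -/

section LowerBound

theorem isGaussian_pi {ι : Type*} [Fintype ι] {E : ι → Type*} [∀ i, NormedAddCommGroup (E i)]
    [∀ i, NormedSpace ℝ (E i)] [∀ i, MeasurableSpace (E i)] [∀ i, BorelSpace (E i)]
    [∀ i, SecondCountableTopology (E i)] [∀ i, CompleteSpace (E i)]
    (μ : ∀ i, Measure (E i)) [∀ i, IsGaussian (μ i)] : IsGaussian (Measure.pi μ) := by
  have h := iIndepFun.hasGaussianLaw (P := Measure.pi μ) (X := fun i (x : ∀ i, E i) => x i)
    (fun i => ⟨by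
      rw [(measurePreserving_eval μ i).map_eq]
      infer_instance⟩)
    (iIndepFun_pi (X := fun i (x : E i) => x) fun i => aemeasurable_id)
  have h' := h.isGaussian_map
  simpa using h'

variable {n p : ℕ}

theorem matrixNormal_map (M M' : Matrix (Fin n) (Fin p) ℝ) {f : Fin n → Fin p → ℝ → ℝ}
    (hf : ∀ i j, Measurable (f i j))
    (h : ∀ i j, (gaussianReal (M i j) 1).map (f i j) = gaussianReal (M' i j) 1) :
    (matrixNormal M).map (fun X => Matrix.of fun i j => f i j (X i j)) = matrixNormal M' := by
  have hp : ∀ (A : Matrix (Fin n) (Fin p) ℝ) (i : Fin n),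
      IsProbabilityMeasure (Measure.pi fun j : Fin p => gaussianReal (A i j) 1) :=
    fun _ _ => inferInstance
  have hg : ∀ i j, SigmaFinite ((gaussianReal (M i j) 1).map (f i j)) := fun i j => by
    rw [h]; infer_instance
  have h1 : ∀ i, (Measure.pi fun j : Fin p => gaussianReal (M i j) 1).map
      (fun r j => f i j (r j)) = Measure.pi fun j : Fin p => gaussianReal (M' i j) 1 := fun i => by
    rw [Measure.pi_map_pi fun j => (hf i j).aemeasurable]
    simp only [h]
  have hg' : ∀ i, SigmaFinite ((Measure.pi fun j : Fin p => gaussianReal (M i j) 1).map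
      (fun r j => f i j (r j))) := fun i => by
    rw [h1]; infer_instance
  have h2 := Measure.pi_map_pi (μ := fun i : Fin n => Measure.pi fun j : Fin p =>
    gaussianReal (M i j) 1) (f := fun i r j => f i j (r j)) fun i =>
      (measurable_pi_iff.2 fun j => (hf i j).comp (measurable_pi_apply j)).aemeasurable
  simp only [h1] at h2
  exact h2

theorem matrixNormal_map_add (M : Matrix (Fin n) (Fin p) ℝ) :
    (matrixNormal 0).map (fun X => M + X) = matrixNormal M :=
  matrixNormal_map 0 M (f := fun i j x => M i j + x) (fun i j => measurable_const_add _)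
    fun i j => by
      rw [gaussianReal_map_const_add]
      simp

theorem matrixNormal_map_neg :
    (matrixNormal (0 : Matrix (Fin n) (Fin p) ℝ)).map (fun X => -X) = matrixNormal 0 :=
  matrixNormal_map 0 0 (f := fun i j x => -x) (fun i j => measurable_neg)
    fun i j => by
      rw [gaussianReal_map_neg]
      simp

/-- Two independent standard normal matrices remain so after a rotation. -/
theorem measurePreserving_rotation_matrixNormal (θ : ℝ) :
    MeasurePreserving (fun x : Matrix (Fin n) (Fin p) ℝ × Matrix (Fin n) (Fin p) ℝ =>
      (Real.cos θ • x.1 + Real.sin θ • x.2, -Real.sin θ • x.1 + Real.cos θ • x.2))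
      ((matrixNormal 0).prod (matrixNormal 0)) ((matrixNormal 0).prod (matrixNormal 0)) := by
  let μ : Measure (Fin n → Fin p → ℝ) :=
    matrixNormal (0 : Matrix (Fin n) (Fin p) ℝ)
  have hrow : ∀ i : Fin n, IsGaussian (Measure.pi fun j : Fin p =>
      gaussianReal ((0 : Matrix (Fin n) (Fin p) ℝ) i j) 1) := fun i => isGaussian_pi _
  have hμ : IsGaussian μ := isGaussian_pi _
  have hneg : μ.map (fun x => -x) = μ := matrixNormal_map_neg
  -- Rotation invariance needs a centred Gaussian measure; centring follows from symmetry under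
  -- negation.
  have hL : ∀ L : StrongDual ℝ (Fin n → Fin p → ℝ), μ[L] = 0 := fun L => by
    have h1 : ∫ x, L x ∂(μ.map fun x => -x) = ∫ x, L (-x) ∂μ :=
      integral_map measurable_neg.aemeasurable L.continuous.aestronglyMeasurable
    rw [hneg] at h1
    simp only [map_neg, integral_neg] at h1
    linarith
  exact ⟨(ContinuousLinearMap.rotation (E := Fin n → Fin p → ℝ) θ).continuous.measurable,
    IsGaussian.map_rotation_eq_self_of_forall_strongDual_eq_zero hL θ⟩

/-- The quadratic form `‖A c‖²`. -/
def gramForm (c : Fin p → ℝ) (A : Matrix (Fin n) (Fin p) ℝ) : ℝ := c ⬝ᵥ ((Aᵀ * A) *ᵥ c)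

theorem gramForm_nonneg (c : Fin p → ℝ) (A : Matrix (Fin n) (Fin p) ℝ) : 0 ≤ gramForm c A := by
  simpa [gramForm] using (posSemidef_gram A).dotProduct_mulVec_nonneg c

theorem gramForm_add_sub (c : Fin p → ℝ) (A B : Matrix (Fin n) (Fin p) ℝ) (k : ℝ) :
    gramForm c (A + k • B) + gramForm c (A + k • -B) =
      2 * gramForm c A + 2 * (k ^ 2 * gramForm c B) := by
  simp only [gramForm, ← dotProduct_add, ← Matrix.add_mulVec, ← smul_eq_mul, ← dotProduct_smul,
    ← Matrix.smul_mulVec]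
  congr 2
  simp only [Matrix.transpose_add, Matrix.transpose_smul, Matrix.transpose_neg, Matrix.add_mul,
    Matrix.mul_add, smul_neg, Matrix.neg_mul, Matrix.mul_neg, Matrix.smul_mul, Matrix.mul_smul]
  module

theorem measurable_gramForm (c : Fin p → ℝ) :
    Measurable (gramForm c : Matrix (Fin n) (Fin p) ℝ → ℝ) := by
  have : Continuous (gramForm c : Matrix (Fin n) (Fin p) ℝ → ℝ) := by
    unfold gramForm
    fun_prop
  exact this.measurable

theorem lintegral_gramForm (c : Fin p → ℝ) :
    ∫⁻ W : Matrix (Fin n) (Fin p) ℝ, ENNReal.ofReal (gramForm c W) ∂(matrixNormal 0) =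
      ENNReal.ofReal (n * (c ⬝ᵥ c)) := by
  have hloss : ∀ (X : Matrix (Fin n) (Fin p) ℝ) i j, matrixLoss 0 (id X) i j =
      ∑ k, (X k i - (0 : Matrix (Fin n) (Fin p) ℝ) k i) *
        (X k j - (0 : Matrix (Fin n) (Fin p) ℝ) k j) := fun X i j => by
    rw [matrixLoss, Matrix.mul_apply]
    rfl
  have hI : ∀ i j, Integrable (fun X : Matrix (Fin n) (Fin p) ℝ => matrixLoss 0 (id X) i j)
      (matrixNormal 0) := fun i j => by
    simp only [hloss]
    exact integrable_sum_sub_mul_sub 0 i j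
  have h := directionalRisk_eq (0 : Matrix (Fin n) (Fin p) ℝ) id c hI
  have hR : matrixRisk (0 : Matrix (Fin n) (Fin p) ℝ) id = (n : ℝ) • 1 := by
    ext i j
    simp only [matrixRisk, Matrix.of_apply, hloss]
    exact integral_sum_sub_mul_sub 0 i j
  rw [hR, Matrix.smul_mulVec, Matrix.one_mulVec, dotProduct_smul, smul_eq_mul] at h
  rw [← h, directionalRisk]
  simp [gramForm, matrixLoss]

/-- Averaging over W and -W cancels the cross terms (parallelogram law), leaving ‖Ac‖² + k² E‖Wc‖².
Working with lower integrals avoids integrability assumptions. -/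
theorem le_lintegral_gramForm_add (c : Fin p → ℝ) (A : Matrix (Fin n) (Fin p) ℝ) (k : ℝ) :
    ENNReal.ofReal (k ^ 2 * (n * (c ⬝ᵥ c))) ≤
      ∫⁻ W, ENNReal.ofReal (gramForm c (A + k • W)) ∂(matrixNormal 0) := by
  have hm : Measurable fun W : Matrix (Fin n) (Fin p) ℝ =>
      ENNReal.ofReal (gramForm c (A + k • W)) := by
    have : Continuous fun W : Matrix (Fin n) (Fin p) ℝ => A + k • W := by fun_prop
    exact ((measurable_gramForm c).comp this.measurable).ennreal_ofReal
  have hneg : Measurable fun W : Matrix (Fin n) (Fin p) ℝ => -W :=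
    (continuous_neg (G := Matrix (Fin n) (Fin p) ℝ)).measurable
  have h1 : ∫⁻ W, ENNReal.ofReal (gramForm c (A + k • -W)) ∂(matrixNormal 0) =
      ∫⁻ W, ENNReal.ofReal (gramForm c (A + k • W)) ∂(matrixNormal 0) := by
    conv_rhs => rw [← matrixNormal_map_neg]
    rw [lintegral_map hm hneg]
  have h2 : 2 * ENNReal.ofReal (k ^ 2 * (n * (c ⬝ᵥ c))) ≤
      2 * ∫⁻ W, ENNReal.ofReal (gramForm c (A + k • W)) ∂(matrixNormal 0) := by
    rw [ENNReal.ofReal_mul (sq_nonneg k), ← lintegral_gramForm,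
      ← lintegral_const_mul _ (measurable_gramForm c).ennreal_ofReal,
      ← lintegral_const_mul' _ _ (by simp), two_mul (∫⁻ _, _ ∂_)]
    nth_rewrite 2 [← h1]
    rw [← lintegral_add_left hm]
    refine lintegral_mono fun W => ?_
    simp only
    rw [← ENNReal.ofReal_add (gramForm_nonneg _ _) (gramForm_nonneg _ _), gramForm_add_sub,
      ← ENNReal.ofReal_mul (sq_nonneg k), show (2 : ℝ≥0∞) = ENNReal.ofReal 2 by simp,
      ← ENNReal.ofReal_mul zero_le_two]
    refine ENNReal.ofReal_le_ofReal ?_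
    have := gramForm_nonneg c A
    linarith
  exact (ENNReal.mul_le_mul_iff_right (by simp) (by simp)).1 h2

theorem directionalRisk_eq_lintegral (M : Matrix (Fin n) (Fin p) ℝ)
    {δ : Matrix (Fin n) (Fin p) ℝ → Matrix (Fin n) (Fin p) ℝ} (hδ : Measurable δ)
    (c : Fin p → ℝ) :
    directionalRisk M δ c =
      ∫⁻ X, ENNReal.ofReal (gramForm c (δ (M + X) - M)) ∂(matrixNormal 0) := by
  have hsub : Continuous fun X : Matrix (Fin n) (Fin p) ℝ => X - M := by fun_prop
  have hadd : Continuous fun X : Matrix (Fin n) (Fin p) ℝ => M + X := by fun_prop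
  rw [directionalRisk, ← matrixNormal_map_add M]
  exact lintegral_map (f := fun X => ENNReal.ofReal (gramForm c (δ X - M)))
    ((measurable_gramForm c).comp (hsub.measurable.comp hδ)).ennreal_ofReal hadd.measurable

/-- Lower bound on the Bayes risk under the normal prior with standard deviation `cot θ`. -/
theorem le_lintegral_directionalRisk {δ : Matrix (Fin n) (Fin p) ℝ → Matrix (Fin n) (Fin p) ℝ}
    (hδ : Measurable δ) (c : Fin p → ℝ) {θ : ℝ} (hθ : Real.sin θ ≠ 0) :
    ENNReal.ofReal (Real.cos θ ^ 2 * (n * (c ⬝ᵥ c))) ≤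
      ∫⁻ G, directionalRisk ((Real.cos θ / Real.sin θ) • G) δ c ∂(matrixNormal 0) := by
  have hrot := measurePreserving_rotation_matrixNormal (n := n) (p := p) θ
  have hks : Real.cos θ * Real.cos θ + Real.sin θ * Real.sin θ = 1 := by
    linarith [Real.cos_sq_add_sin_sq θ]
  generalize Real.cos θ = k at *
  generalize Real.sin θ = s at *
  -- With M = (k/s)G and X = M + H, put U = kG + sH = sX and W = -sG + kH. Then M = (k²/s)U - kW, so
  -- the error is a function of U plus kW; Φ is the loss in the coordinates (U, W).
  obtain ⟨Φ, hΦ_def⟩ : ∃ Φ : Matrix (Fin n) (Fin p) ℝ × Matrix (Fin n) (Fin p) ℝ → ℝ≥0∞,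
    ∀ x, Φ x = ENNReal.ofReal
      (gramForm c ((δ (s⁻¹ • x.1) - (k ^ 2 / s) • x.1) + k • x.2)) := ⟨_, fun _ => rfl⟩
  have hΦ : Measurable Φ := by
    rw [funext hΦ_def]
    have h1 : Continuous fun X : Matrix (Fin n) (Fin p) ℝ => s⁻¹ • X := by fun_prop
    have h2 : Continuous fun x : (Matrix (Fin n) (Fin p) ℝ × Matrix (Fin n) (Fin p) ℝ) ×
        Matrix (Fin n) (Fin p) ℝ => (x.2 - (k ^ 2 / s) • x.1.1) + k • x.1.2 := by fun_prop
    exact ((measurable_gramForm c).comp (h2.measurable.comp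
      (measurable_id.prodMk (hδ.comp (h1.measurable.comp measurable_fst))))).ennreal_ofReal
  have hF : ∀ G H : Matrix (Fin n) (Fin p) ℝ,
      ENNReal.ofReal (gramForm c (δ ((k / s) • G + H) - (k / s) • G)) =
        Φ (k • G + s • H, -s • G + k • H) := fun G H => by
    rw [hΦ_def]
    simp only
    have e1 : s⁻¹ • (k • G + s • H) = (k / s) • G + H := by
      rw [smul_add, smul_smul, smul_smul, inv_mul_cancel₀ hθ, one_smul, div_eq_inv_mul]
    have e2 : (k ^ 2 / s) • (k • G + s • H) - k • (-s • G + k • H) = (k / s) • G := by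
      have h1 : k ^ 2 / s * k + k * s = k / s := by
        rw [show k ^ 2 / s * k + k * s = k * (k * k + s * s) / s by field_simp, hks, mul_one]
      have h2 : k ^ 2 / s * s - k * k = 0 := by
        field_simp
        ring
      calc _ = (k ^ 2 / s * k + k * s) • G + (k ^ 2 / s * s - k * k) • H := by module
        _ = _ := by rw [h1, h2, zero_smul, add_zero]
    rw [e1, ← e2]
    congr 2
    abel
  calc ENNReal.ofReal (k ^ 2 * (n * (c ⬝ᵥ c)))
      = ∫⁻ _ : Matrix (Fin n) (Fin p) ℝ, ENNReal.ofReal (k ^ 2 * (n * (c ⬝ᵥ c)))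
          ∂(matrixNormal 0) := by simp
    -- For fixed U the estimator's contribution is a constant shift, which cannot reduce the mean
    -- square of kW.
    _ ≤ ∫⁻ U, ∫⁻ W, Φ (U, W) ∂(matrixNormal 0) ∂(matrixNormal 0) :=
        by
        refine lintegral_mono fun U => ?_
        simp only [hΦ_def]
        exact le_lintegral_gramForm_add c _ k
    _ = ∫⁻ x, Φ x ∂((matrixNormal 0).prod (matrixNormal 0)) :=
        (lintegral_prod _ hΦ.aemeasurable).symm
    _ = ∫⁻ x : Matrix (Fin n) (Fin p) ℝ × Matrix (Fin n) (Fin p) ℝ,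
          Φ (k • x.1 + s • x.2, -s • x.1 + k • x.2)
          ∂((matrixNormal 0).prod (matrixNormal 0)) := (hrot.lintegral_comp hΦ).symm
    _ = ∫⁻ G, ∫⁻ H, Φ (k • G + s • H, -s • G + k • H) ∂(matrixNormal 0) ∂(matrixNormal 0) :=
        lintegral_prod _ (hΦ.comp hrot.measurable).aemeasurable
    _ = _ := by
        simp only [← hF, directionalRisk_eq_lintegral _ hδ]

/-- Every estimator has maximal directional risk at least `n ‖c‖²`. -/
theorem le_iSup_directionalRisk {δ : Matrix (Fin n) (Fin p) ℝ → Matrix (Fin n) (Fin p) ℝ}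
    (hδ : Measurable δ) (c : Fin p → ℝ) :
    ENNReal.ofReal (n * (c ⬝ᵥ c)) ≤ ⨆ M, directionalRisk M δ c := by
  -- The supremum dominates every Bayes risk; the angles θ = 1/(m+1) lie in (0, π) and tend to 0, so
  -- the prior flattens and cos²θ → 1.
  have h1 : ∀ m : ℕ, ENNReal.ofReal (Real.cos (ridgeSeq m) ^ 2 * (n * (c ⬝ᵥ c))) ≤
      ⨆ M, directionalRisk M δ c := fun m => by
    have hlt : ridgeSeq m < Real.pi := by
      have : ridgeSeq m ≤ 1 := by
        rw [ridgeSeq, div_le_one (by positivity)]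
        linarith [Nat.cast_nonneg (α := ℝ) m]
      linarith [Real.pi_gt_three]
    refine (le_lintegral_directionalRisk hδ c
      (Real.sin_pos_of_pos_of_lt_pi (ridgeSeq_pos m) hlt).ne').trans ?_
    refine (lintegral_mono fun G => le_iSup (fun M => directionalRisk M δ c) _).trans ?_
    simp
  have hc : Continuous fun x : ℝ => ENNReal.ofReal (Real.cos x ^ 2 * (n * (c ⬝ᵥ c))) := by
    exact ENNReal.continuous_ofReal.comp (by fun_prop)
  have h2 := (hc.tendsto 0).comp tendsto_ridgeSeq
  simp only [Real.cos_zero, one_pow, one_mul] at h2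
  exact le_of_tendsto' h2 h1

/-- The common value n‖c‖² bounds this estimator's risk above and every estimator's maximal risk
below. -/
theorem isMinimax_efronMorris (hd : 0 < (n : ℝ) - p - 1) :
    IsMinimax (efronMorris (n := n) (p := p)) :=
  ⟨measurable_efronMorris, fun c => le_antisymm
    ((iSup_le fun M => directionalRisk_efronMorris_le M hd c).trans
      (le_iInf₂ fun _ hδ => le_iSup_directionalRisk hδ c))
    (iInf₂_le _ measurable_efronMorris)⟩

end LowerBound

end MatrixQuadratic

/-- Minimaxity and risk of the Efron–Morris estimator. The Löwner inequality `R ⪯ n I_p` is stated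
as positive semidefiniteness of the difference. -/
theorem mainTheorem6 (n p : ℕ) (hnp : 0 < (n : ℤ) - (p : ℤ) - 1) :
    MatrixQuadratic.IsMinimax (MatrixQuadratic.efronMorris (n := n) (p := p)) ∧
    ∀ M : Matrix (Fin n) (Fin p) ℝ,
      (∀ᵐ X : Matrix (Fin n) (Fin p) ℝ ∂(MatrixQuadratic.matrixNormal M), IsUnit (Xᵀ * X)) ∧
      (∀ i j, Integrable (fun X : Matrix (Fin n) (Fin p) ℝ => (Xᵀ * X)⁻¹ i j)
        (MatrixQuadratic.matrixNormal M)) ∧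
      (∀ i j, Integrable
        (fun X => MatrixQuadratic.matrixLoss M (MatrixQuadratic.efronMorris X) i j)
        (MatrixQuadratic.matrixNormal M)) ∧
      MatrixQuadratic.matrixRisk M MatrixQuadratic.efronMorris =
        (n : ℝ) • (1 : Matrix (Fin p) (Fin p) ℝ) -
          ((n : ℝ) - (p : ℝ) - 1) ^ 2 • MatrixQuadratic.expectedInvGram M ∧
      ((n : ℝ) • (1 : Matrix (Fin p) (Fin p) ℝ) -
        MatrixQuadratic.matrixRisk M MatrixQuadratic.efronMorris).PosSemidef := by
  have hd : 0 < (n : ℝ) - p - 1 := by exact_mod_cast hnp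
  exact ⟨MatrixQuadratic.isMinimax_efronMorris hd, fun M =>
    ⟨MatrixQuadratic.ae_isUnit_gram M hd, MatrixQuadratic.integrable_invGram_apply M hd,
      MatrixQuadratic.integrable_matrixLoss_efronMorris M hd,
      MatrixQuadratic.matrixRisk_efronMorris M hd,
      MatrixQuadratic.posSemidef_sub_matrixRisk_efronMorris M hd⟩⟩
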